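/- **Setting.** Let $X$ be a complex Hilbert space. For $d\in(0,\pi/2)$ let $$\mathcal D_d=\{z\in\mathbb C:\ |\arg(z+\sqrt{1+z^2})|<d\},$$ with principal branches; this is the image of the strip $\{|\operatorname{Im} w|<d\}$ under $\sinh$, and $\partial\mathcal D_r$ ($0<r<\pi/2$) consists of the curves $t\mapsto\sinh(t\pm \imath r)$, $t\in\mathbb R$. Let $\mathcal N_2(\mathcal D_d;X)$ be the set of all $F$ that are analytic in $\mathcal D_d$ with values in $X$ and satisfy $$\|F\|_{\mathcal N_2(\mathcal D_d;X)}:=\Big(\sup_{0<r<d}\int_{\partial\mathcal D_r}\|F(z)\|_X^2\,|\mathrm dz|\Big)^{1/2}<\infty,$$ that is, the boundary integral $\int_{\partial \mathcal D_d}\|F(z)\|_X^2\,|\mathrm dz|$ is understood in the Hardy space sense. For $x\in\mathbb R$ put $\phi(x)=\sinh^{-1}(x)=\log(x+\sqrt{1+x^2})$, and for $\vartheta>0$, $k\in\mathbb Z$ put $z_k=\sinh(k\vartheta)$ and $$\mathrm{Sinc}(k,\vartheta)(x)=\frac{\sin(\pi(x-k\vartheta)/\vartheta)}{\pi(x-k\vartheta)/\vartheta}\quad(\text{with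 value }1\text{ at }x=k\vartheta).$$ **Theorem.** There is a function $d\mapsto C(d)>0$ on $(0,\pi/2)$, depending only on $d$ (in particular not on $X$, $F$, $C$, $K$), with $C(d)\to\infty$ as $d\to0$, such that the following holds for every complex Hilbert space $X$ and every $d\in(0,\pi/2)$. Let $F\in\mathcal N_2(\mathcal D_d;X)$ and suppose that, for some $C>0$, $\|F(x)\|_X\le \frac{C}{\sqrt{1+x^2}}$ for all $x\in\mathbb R$. For each integer $K\ge1$ set $\vartheta=\left(\frac{2\pi d}{K}\right)^{1/2}$. Then $F-(\phi')^{1/2}\sum_{k=-K}^{K}\frac{F(z_k)}{\phi'(z_k)^{1/2}}\,\mathrm{Sinc}(k,\vartheta)\circ\phi$ belongs to $L^2(\mathbb R;X)$ and $$\Big\|F-(\phi')^{1/2}\sum_{k=-K}^{K}\frac{F(z_k)}{\phi'(z_k)^{1/2}}\,\mathrm{Sinc}(k,\vartheta)\circ\phi\Big\|_{L^2(\mathbb R;X)}\le C(d)\,K^{1/4}\exp\left(-\sqrt{\frac{\pi dK}{2}}\right)\big(\|F\|_{\mathcal N_2(\mathcal D_d;X)}+C\big).$$ -/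

import Mathlib

open scoped ENNReal

noncomputable section

namespace SincApprox

/-- The domain `D_d = {z : |arg (z + √(1 + z²))| < d}`, with principal branches of the
argument and of the square root. -/
def domain (d : ℝ) : Set ℂ :=
  {z : ℂ | |Complex.arg (z + (1 + z ^ 2) ^ (1 / 2 : ℂ))| < d}

/-- The curve `t ↦ sinh (t + i y)`. For `0 < r < π / 2` the boundary of `domain r` consists of the
two curves with `y = r` and `y = -r`. -/
def curve (y : ℝ) (t : ℝ) : ℂ := Complex.sinh ((t : ℂ) + (y : ℂ) * Complex.I)

/-- The arc length integral `∫_γ g(z) |dz|` of a nonnegative function along a curve `γ`. -/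
def arcLengthIntegral (γ : ℝ → ℂ) (g : ℂ → ℝ≥0∞) : ℝ≥0∞ :=
  ∫⁻ t : ℝ, g (γ t) * ‖deriv γ t‖ₑ

/-- `∫_{∂ D_r} ‖F(z)‖^p |dz|`. -/
def boundaryIntegral {X : Type*} [NormedAddCommGroup X] (p : ℝ) (r : ℝ) (F : ℂ → X) : ℝ≥0∞ :=
  arcLengthIntegral (curve r) (fun z => ‖F z‖ₑ ^ p) +
    arcLengthIntegral (curve (-r)) (fun z => ‖F z‖ₑ ^ p)

/-- The Hardy type norm `‖F‖_{N_p(D_d; X)}`. A member of the space is only given on the open set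
`D_d`, so the integral over `∂ D_d` is taken in the Hardy space sense, as the supremum of the
integrals over the boundaries `∂ D_r` with `0 < r < d`. -/
def hardyNorm {X : Type*} [NormedAddCommGroup X] (p : ℝ) (d : ℝ) (F : ℂ → X) : ℝ≥0∞ :=
  (⨆ r ∈ Set.Ioo (0 : ℝ) d, boundaryIntegral p r F) ^ (1 / p)

/-- Membership in `N_p(D_d; X)`: analytic in `D_d` and of finite norm. -/
def MemHardy {X : Type*} [NormedAddCommGroup X] [NormedSpace ℂ X] (p : ℝ) (d : ℝ)
    (F : ℂ → X) : Prop :=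
  AnalyticOnNhd ℂ F (domain d) ∧ hardyNorm p d F < ∞

/-- The conformal map `φ(x) = arsinh x = log (x + √(1 + x²))`, on the real line. -/
def phi (x : ℝ) : ℝ := Real.arsinh x

/-- The sinc points `z_k = sinh (k ϑ)`. -/
def sincPoint (θ : ℝ) (k : ℤ) : ℝ := Real.sinh ((k : ℝ) * θ)

/-- `Sinc(k, ϑ)(x) = sin (π (x - k ϑ) / ϑ) / (π (x - k ϑ) / ϑ)`, with value `1` at `x = k ϑ`. -/
def Sinc (k : ℤ) (θ : ℝ) (x : ℝ) : ℝ := Real.sinc (Real.pi * (x - (k : ℝ) * θ) / θ)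

/-- The truncated sinc interpolant
`(φ'(x))^{1/2} ∑_{k = -K}^{K} F(z_k) / φ'(z_k)^{1/2} · Sinc(k, ϑ)(φ(x))`. -/
def interpolant {X : Type*} [NormedAddCommGroup X] [NormedSpace ℂ X] (θ : ℝ) (K : ℕ)
    (F : ℂ → X) (x : ℝ) : X :=
  √(deriv phi x) • ∑ k ∈ Finset.Icc (-(K : ℤ)) (K : ℤ),
    (Sinc k θ (phi x) / √(deriv phi (sincPoint θ k))) • F ((sincPoint θ k : ℝ) : ℂ)

end SincApprox

end

/-! The substitution `x = sinh w` replaces `F` by `G(w) = cosh(w)^{1/2} F(sinh w)`, holomorphic on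
the strip `|Im w| < d`. It preserves `L²` on the real line, turns the arc length integrals into
squared `L²` norms of `G` on horizontal lines, and makes the interpolant the plain truncated sinc
series of `G` with step `θ` (`lintegral_pullback_line`, `eLpNorm_sub_interpolant`). The error then
splits into a discretization part and a truncation part.

Discretization: Cauchy's formula expresses `G(t)` by Cauchy transforms of `G` on the lines `Im w =
±r` (`cauchy_formula_strip`). By the partial fractions of the cosecant, the sinc series reproduces
the Cauchy kernel with pole `w` up to the factor `sin(πt/θ) / sin(πw/θ)` (`tendsto_sum_Sinc_div`).
Hence the error of the full series is `(2πi)⁻¹ sin(πt/θ)` times a Cauchy transform of `G /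
sin(π·/θ)`, and on these lines `1/|sin|` is at most `1 / sinh(πr/θ)`. What remains is an `L²` bound
for the Cauchy transform that is uniform in `r` (`eLpNorm_cauchyTransform_le`). Here the Hilbert
space enters: the transforms with parameters `r` and `-r` are orthogonal, so each is dominated by
their difference, a convolution with `2πi` times a Poisson kernel.

Truncation: the decay of `F` gives `G(t) = O(e^{-|t|/2})` on the real line, and the triangle
inequality with a geometric series bounds the omitted terms by `8 C e^{-Kθ/2} / √θ`. The chosen `θ`
balances the exponents, `πd/θ = Kθ/2 = √(πdK/2)`, and `1/√θ` produces `K^{1/4}`.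

Since `L²` boundary values need not be integrable, these steps are carried out for `exp(-εw²) G(w)`
on lines `|Im w| = r < d`; Fatou's lemma then lets `ε → 0` and `r → d`. -/

namespace SincApprox

open MeasureTheory Filter Topology

/-! ### Young's inequality for correlations -/

section Young

variable {α : Type*} [MeasurableSpace α]

/-- Cauchy–Schwarz after the splitting `f g = f^{1/2} · (f^{1/2} g)`. -/
theorem sq_lintegral_mul_le {μ : Measure α} {f g : α → ℝ≥0∞}
    (hf : AEMeasurable f μ) (hg : AEMeasurable g μ) :
    (∫⁻ a, f a * g a ∂μ) ^ 2 ≤ (∫⁻ a, f a ∂μ) * ∫⁻ a, f a * g a ^ 2 ∂μ := by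
  have h := ENNReal.lintegral_mul_le_Lp_mul_Lq μ (p := 2) (q := 2)
    (by constructor <;> norm_num) (hf.pow_const (1 / 2 : ℝ))
    ((hf.pow_const (1 / 2 : ℝ)).mul hg)
  have e : ∀ x : ℝ≥0∞, x ^ (1 / 2 : ℝ) * x ^ (1 / 2 : ℝ) = x := fun x => by
    rw [← ENNReal.rpow_add_of_nonneg _ _ (by norm_num) (by norm_num)]; norm_num
  have e2 : ∀ x : ℝ≥0∞, (x ^ (1 / 2 : ℝ)) ^ (2 : ℝ) = x := fun x => by
    rw [← ENNReal.rpow_mul]; norm_num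
  simp only [Pi.mul_apply, ← mul_assoc, e, e2, ENNReal.mul_rpow_of_nonneg _ _ zero_le_two,
    ENNReal.rpow_two] at h
  calc _ ≤ _ := pow_le_pow_left' h 2
    _ = _ := by
      rw [mul_pow, ← ENNReal.rpow_two, ← ENNReal.rpow_two, e2, e2]

theorem eLpNorm_two_sq {E : Type*} [NormedAddCommGroup E] (μ : Measure α) (f : α → E) :
    eLpNorm f 2 μ ^ 2 = ∫⁻ a, ‖f a‖ₑ ^ 2 ∂μ := by
  rw [eLpNorm_eq_lintegral_rpow_enorm_toReal two_ne_zero ENNReal.ofNat_ne_top,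
    ← ENNReal.rpow_two, ← ENNReal.rpow_mul]
  simp

theorem eLpNorm_two_le {E : Type*} [NormedAddCommGroup E] {μ : Measure α} {f : α → E}
    {c : ℝ≥0∞} (h : ∫⁻ a, ‖f a‖ₑ ^ 2 ∂μ ≤ c ^ 2) : eLpNorm f 2 μ ≤ c := by
  rw [← eLpNorm_two_sq] at h
  exact (ENNReal.pow_le_pow_left_iff two_ne_zero).1 h

variable {X : Type*} [NormedAddCommGroup X] [NormedSpace ℂ X]

theorem aestronglyMeasurable_correlation {κ : ℝ → ℂ} {u : ℝ → X} (hκ : Continuous κ)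
    (hu : Continuous u) : AEStronglyMeasurable (fun t => ∫ s, κ (s - t) • u s) volume := by
  have : AEStronglyMeasurable (fun p : ℝ × ℝ => κ (p.2 - p.1) • u p.2)
      (volume.prod volume) := Continuous.aestronglyMeasurable (by fun_prop)
  exact this.integral_prod_right'

theorem lintegral_enorm_correlation_le {κ : ℝ → ℂ} {u : ℝ → X} (t : ℝ) :
    ‖∫ s, κ (s - t) • u s‖ₑ ≤ ∫⁻ s, ‖κ (s - t)‖ₑ * ‖u s‖ₑ := by
  refine (enorm_integral_le_lintegral_enorm _).trans_eq ?_
  simp only [enorm_smul]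

theorem lintegral_sq_correlation_le_left {f g : ℝ → ℝ≥0∞} (hf : Measurable f)
    (hg : Measurable g) :
    ∫⁻ t, (∫⁻ s, f (s - t) * g s) ^ 2 ≤ (∫⁻ x, f x) ^ 2 * ∫⁻ x, g x ^ 2 := by
  calc ∫⁻ t, (∫⁻ s, f (s - t) * g s) ^ 2
      ≤ ∫⁻ t, (∫⁻ x, f x) * ∫⁻ s, f (s - t) * g s ^ 2 := by
        refine lintegral_mono fun t => ?_
        refine (sq_lintegral_mul_le (by fun_prop) (by fun_prop)).trans_eq ?_
        rw [lintegral_sub_right_eq_self f]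
    _ = (∫⁻ x, f x) * ∫⁻ s, ∫⁻ t, f (s - t) * g s ^ 2 := by
        rw [lintegral_const_mul, lintegral_lintegral_swap]
        · exact Measurable.aemeasurable (by fun_prop)
        · exact Measurable.lintegral_prod_right' (f := fun p : ℝ × ℝ => f (p.2 - p.1) * g p.2 ^ 2)
            (by fun_prop)
    _ = _ := by
        rw [sq, mul_assoc]
        congr 1
        rw [← lintegral_const_mul _ (by fun_prop)]
        refine lintegral_congr fun s => ?_
        rw [lintegral_mul_const _ (by fun_prop), lintegral_sub_left_eq_self f]

theorem lintegral_sq_correlation_le_right {f g : ℝ → ℝ≥0∞} (hf : Measurable f)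
    (hg : Measurable g) :
    ∫⁻ t, (∫⁻ s, f (s - t) * g s) ^ 2 ≤ (∫⁻ x, g x) ^ 2 * ∫⁻ x, f x ^ 2 := by
  calc ∫⁻ t, (∫⁻ s, f (s - t) * g s) ^ 2
      ≤ ∫⁻ t, (∫⁻ x, g x) * ∫⁻ s, g s * f (s - t) ^ 2 := by
        refine lintegral_mono fun t => ?_
        simp only [mul_comm (f _)]
        exact sq_lintegral_mul_le (by fun_prop) (by fun_prop)
    _ = (∫⁻ x, g x) * ∫⁻ s, ∫⁻ t, g s * f (s - t) ^ 2 := by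
        rw [lintegral_const_mul, lintegral_lintegral_swap]
        · exact Measurable.aemeasurable (by fun_prop)
        · exact Measurable.lintegral_prod_right' (f := fun p : ℝ × ℝ => g p.2 * f (p.2 - p.1) ^ 2)
            (by fun_prop)
    _ = _ := by
        rw [sq, mul_assoc]
        congr 1
        rw [← lintegral_mul_const _ (by fun_prop)]
        refine lintegral_congr fun s => ?_
        rw [lintegral_const_mul _ (by fun_prop), lintegral_sub_left_eq_self (fun x => f x ^ 2)]

/-- The quantitative estimate, applied later to the Poisson kernel. -/
theorem eLpNorm_correlation_le_of_kernel_L1 {κ : ℝ → ℂ} {u : ℝ → X} (hκ : Continuous κ)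
    (hu : Continuous u) :
    eLpNorm (fun t => ∫ s, κ (s - t) • u s) 2 volume ≤ (∫⁻ x, ‖κ x‖ₑ) * eLpNorm u 2 volume := by
  apply eLpNorm_two_le
  rw [mul_pow, eLpNorm_two_sq]
  exact (lintegral_mono fun t => pow_le_pow_left' (lintegral_enorm_correlation_le t) 2).trans
    (lintegral_sq_correlation_le_left hκ.enorm.measurable hu.enorm.measurable)

/-- Only qualitative use: it puts the Cauchy transform of an integrable function in `L²`. Its bound
depends on `r` and on the `L¹` norm of `u`. -/
theorem eLpNorm_correlation_le_of_kernel_L2 {κ : ℝ → ℂ} {u : ℝ → X} (hκ : Continuous κ)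
    (hu : Continuous u) :
    eLpNorm (fun t => ∫ s, κ (s - t) • u s) 2 volume ≤ (∫⁻ x, ‖u x‖ₑ) * eLpNorm κ 2 volume := by
  apply eLpNorm_two_le
  rw [mul_pow, eLpNorm_two_sq]
  exact (lintegral_mono fun t => pow_le_pow_left' (lintegral_enorm_correlation_le t) 2).trans
    (lintegral_sq_correlation_le_right hκ.enorm.measurable hu.enorm.measurable)

end Young

/-! ### The Cauchy kernel on a horizontal line -/

section CauchyKernel

/-- The Cauchy kernel `x ↦ 1 / (x - i r)` on the real line. -/
noncomputable def cauchyKernel (r x : ℝ) : ℂ := ((x : ℂ) - r * Complex.I)⁻¹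

theorem sub_mul_I_ne_zero {r : ℝ} (hr : r ≠ 0) (x : ℝ) : (x : ℂ) - r * Complex.I ≠ 0 := fun h => by
  have := congrArg Complex.im h
  simp at this
  exact hr this

theorem continuous_cauchyKernel {r : ℝ} (hr : r ≠ 0) : Continuous (cauchyKernel r) := by
  unfold cauchyKernel
  exact Continuous.inv₀ (by fun_prop) (sub_mul_I_ne_zero hr)

theorem norm_cauchyKernel_sq (r x : ℝ) : ‖cauchyKernel r x‖ ^ 2 = (x ^ 2 + r ^ 2)⁻¹ := by
  rw [cauchyKernel, norm_inv, inv_pow, ← Complex.normSq_eq_norm_sq, Complex.normSq_apply]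
  simp; ring_nf

theorem integrable_inv_sq_add_sq {r : ℝ} (hr : r ≠ 0) :
    Integrable fun x : ℝ => (x ^ 2 + r ^ 2)⁻¹ := by
  have := (integrable_inv_one_add_sq.comp_div hr).const_mul (r ^ 2)⁻¹
  refine this.congr (Eventually.of_forall fun x => ?_)
  simp only
  rw [← mul_inv]; congr 1; field_simp; ring

theorem integral_inv_sq_add_sq {r : ℝ} (hr : r ≠ 0) :
    ∫ x : ℝ, (x ^ 2 + r ^ 2)⁻¹ = Real.pi / |r| := by
  have h : ∀ x : ℝ, (x ^ 2 + r ^ 2)⁻¹ = (r ^ 2)⁻¹ * (1 + (x / r) ^ 2)⁻¹ := fun x => by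
    rw [← mul_inv]; congr 1; field_simp; ring
  simp_rw [h]
  rw [integral_const_mul, Measure.integral_comp_div (fun x => (1 + x ^ 2)⁻¹),
    integral_univ_inv_one_add_sq, ← sq_abs]
  have := abs_pos.2 hr
  simp only [smul_eq_mul]; field_simp

theorem memLp_cauchyKernel {r : ℝ} (hr : r ≠ 0) : MemLp (cauchyKernel r) 2 volume := by
  rw [memLp_two_iff_integrable_sq_norm (continuous_cauchyKernel hr).aestronglyMeasurable]
  simp only [norm_cauchyKernel_sq]
  exact integrable_inv_sq_add_sq hr

theorem norm_cauchyKernel_le {r : ℝ} (hr : r ≠ 0) (x : ℝ) : ‖cauchyKernel r x‖ ≤ |r|⁻¹ := by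
  rw [cauchyKernel, norm_inv]
  refine inv_anti₀ (abs_pos.2 hr) ?_
  simpa using Complex.abs_im_le_norm ((x : ℂ) - r * Complex.I)

theorem conj_cauchyKernel (r x : ℝ) : (starRingEnd ℂ) (cauchyKernel r x) = cauchyKernel (-r) x := by
  simp [cauchyKernel]

/-- The jump across the real line is `2πi` times the Poisson kernel, which is integrable although
each Cauchy kernel is not. -/
theorem cauchyKernel_sub (r x : ℝ) (hr : r ≠ 0) :
    cauchyKernel r x - cauchyKernel (-r) x = ((2 * r * (x ^ 2 + r ^ 2)⁻¹ : ℝ) : ℂ) * Complex.I := by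
  have h1 := sub_mul_I_ne_zero hr x
  have h2 := sub_mul_I_ne_zero (neg_ne_zero.2 hr) x
  have h3 : ((x : ℂ) ^ 2 + r ^ 2) = ((x : ℂ) - r * Complex.I) * (x - (-r : ℝ) * Complex.I) := by
    push_cast; linear_combination (r : ℂ) ^ 2 * Complex.I_sq
  push_cast
  rw [h3, cauchyKernel, cauchyKernel, inv_sub_inv h1 h2, div_eq_mul_inv]
  push_cast
  ring

/-- As functions of `t`, both factors have their poles in the same half plane, so closing the
contour in the other one gives zero. The proof uses an explicit antiderivative instead: a multiple
of the logarithm of `(t - s + ir)/(t - s' + ir)`, which vanishes at both ends. -/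
theorem integral_cauchyKernel_mul {r : ℝ} (hr : r ≠ 0) (s s' : ℝ) (hs : s ≠ s') :
    ∫ t : ℝ, cauchyKernel r (s - t) * cauchyKernel r (s' - t) = 0 := by
  have hne : ∀ a t : ℝ, (t : ℂ) - a + r * Complex.I ≠ 0 := fun a t h => by
    have := congrArg Complex.im h
    simp at this
    exact hr this
  have hss : (s : ℂ) - s' ≠ 0 := by
    rw [sub_ne_zero]; exact_mod_cast hs
  have hq : ∀ t : ℝ, ((t : ℂ) - s + r * Complex.I) / ((t : ℂ) - s' + r * Complex.I) =
      1 + (s' - s) / ((t : ℂ) - s' + r * Complex.I) := fun t => by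
    field_simp [hne s' t]; ring
  -- If the quotient is a real number `c`, comparing imaginary parts gives `r = c r`, so `c = 1`.
  -- The negative axis is never met and the principal logarithm is smooth along the path.
  have hslit : ∀ t : ℝ, ((t : ℂ) - s + r * Complex.I) / ((t : ℂ) - s' + r * Complex.I) ∈
      Complex.slitPlane := fun t => by
    by_contra hc
    rw [Complex.mem_slitPlane_iff, not_or, not_lt, not_not] at hc
    obtain ⟨c, hc'⟩ : ∃ c : ℝ, ((t : ℂ) - s + r * Complex.I) / ((t : ℂ) - s' + r * Complex.I) = c :=
      ⟨_, (Complex.ext (by simp) (by simpa using hc.2) :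
        _ = (((((t : ℂ) - s + r * Complex.I) / ((t : ℂ) - s' + r * Complex.I)).re : ℝ) : ℂ))⟩
    rw [hc'] at hc
    rw [div_eq_iff (hne _ _)] at hc'
    have := congrArg Complex.im hc'
    simp at this
    have h1 : c = 1 := by
      have : r * (c - 1) = 0 := by linarith
      rcases mul_eq_zero.1 this with h | h
      · exact absurd h hr
      · linarith
    rw [h1] at hc
    norm_num at hc
  have hderiv : ∀ t : ℝ, HasDerivAt (fun t : ℝ => ((s : ℂ) - s')⁻¹ *
      Complex.log (((t : ℂ) - s + r * Complex.I) / ((t : ℂ) - s' + r * Complex.I)))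
      (cauchyKernel r (s - t) * cauchyKernel r (s' - t)) t := fun t => by
    have h1 : ∀ a : ℝ, HasDerivAt (fun t : ℝ => (t : ℂ) - a + r * Complex.I) 1 t := fun a =>
      ((Complex.ofRealCLM.hasDerivAt (x := t)).sub_const _).add_const _
    have := (((h1 s).div (h1 s') (hne _ _)).clog_real (hslit t)).const_mul ((s : ℂ) - s')⁻¹
    refine this.congr_deriv ?_
    have hk : ∀ a : ℝ, cauchyKernel r (a - t) = - ((t : ℂ) - a + r * Complex.I)⁻¹ := fun a => by
      rw [cauchyKernel, ← inv_neg]; congr 1; push_cast; ring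
    rw [hk, hk]
    simp only [Pi.div_apply]
    have a1 := hne s t
    have a2 := hne s' t
    field_simp
    ring
  have hlim : ∀ l : Filter ℝ, Tendsto (fun t : ℝ => ‖(t : ℂ) - s' + r * Complex.I‖) l atTop →
      Tendsto (fun t : ℝ => ((s : ℂ) - s')⁻¹ *
      Complex.log (((t : ℂ) - s + r * Complex.I) / ((t : ℂ) - s' + r * Complex.I))) l (𝓝 0) := by
    intro l hl
    have h0 : Tendsto (fun t : ℝ => ((t : ℂ) - s + r * Complex.I) / ((t : ℂ) - s' + r * Complex.I)) l
        (𝓝 1) := by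
      simp_rw [hq]
      have := (tendsto_inv₀_cobounded.comp (tendsto_norm_atTop_iff_cobounded.1 hl)).const_mul
        ((s' : ℂ) - s)
      simpa [div_eq_mul_inv] using this.const_add 1
    have := ((continuousAt_clog (by simp)).tendsto.comp h0).const_mul ((s : ℂ) - s')⁻¹
    simpa using this
  have hre : ∀ t : ℝ, |t - s'| ≤ ‖(t : ℂ) - s' + r * Complex.I‖ := fun t => by
    simpa using Complex.abs_re_le_norm ((t : ℂ) - s' + r * Complex.I)
  have hint : Integrable fun t : ℝ => cauchyKernel r (s - t) * cauchyKernel r (s' - t) := by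
    have h := fun a : ℝ => (memLp_cauchyKernel hr).comp_measurePreserving
      (Measure.measurePreserving_sub_left volume a)
    exact MemLp.integrable_mul (h s) (h s')
  rw [integral_of_hasDerivAt_of_tendsto hderiv hint (hlim _ ?_) (hlim _ ?_), sub_zero]
  · refine tendsto_atTop_mono hre ?_
    exact tendsto_abs_atBot_atTop.comp (tendsto_atBot_add_const_right _ _ tendsto_id)
  · refine tendsto_atTop_mono hre ?_
    exact tendsto_abs_atTop_atTop.comp (tendsto_atTop_add_const_right _ _ tendsto_id)

end CauchyKernel

/-! ### `L²` bound for the Cauchy transform -/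

section CauchyTransform

variable {X : Type*} [NormedAddCommGroup X] [InnerProductSpace ℂ X]

/-- The Cauchy transform `t ↦ ∫ u(s) / (s - t - i r) ds` of `u`. -/
noncomputable def cauchyTransform (r : ℝ) (u : ℝ → X) (t : ℝ) : X :=
  ∫ s, cauchyKernel r (s - t) • u s

theorem integrable_cauchyKernel_smul {r : ℝ} (hr : r ≠ 0) {u : ℝ → X} (hu : Integrable u)
    (t : ℝ) : Integrable fun s => cauchyKernel r (s - t) • u s :=
  hu.bdd_smul |r|⁻¹ ((continuous_cauchyKernel hr).comp
    (continuous_id.sub continuous_const)).aestronglyMeasurable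
    (Eventually.of_forall fun _ => norm_cauchyKernel_le hr _)

theorem memLp_cauchyTransform {r : ℝ} (hr : r ≠ 0) {u : ℝ → X} (hu : Continuous u)
    (hi : Integrable u) : MemLp (cauchyTransform r u) 2 volume :=
  ⟨aestronglyMeasurable_correlation (continuous_cauchyKernel hr) hu,
    (eLpNorm_correlation_le_of_kernel_L2 (continuous_cauchyKernel hr) hu).trans_lt
      (ENNReal.mul_lt_top hi.2 (memLp_cauchyKernel hr).2)⟩

variable [CompleteSpace X]

/-- The two transforms are boundary values of functions in opposite half planes. By Fubini, and
since conjugation exchanges the kernels of `r` and `-r`, the pairing reduces to integrals over `t`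
of products of two kernels with the same `r`, which vanish off the null set `s = s'`. -/
theorem integral_inner_cauchyTransform {r : ℝ} (hr : r ≠ 0) {u : ℝ → X} (hu : Continuous u)
    (hi : Integrable u) :
    ∫ t, inner ℂ (cauchyTransform (-r) u t) (cauchyTransform r u t) = 0 := by
  have hk := continuous_cauchyKernel hr
  have ha := memLp_cauchyTransform hr hu hi
  have ham : AEStronglyMeasurable (cauchyTransform r u) volume := ha.1
  have hkL := fun s : ℝ => (memLp_cauchyKernel hr).comp_measurePreserving
      (Measure.measurePreserving_sub_left volume s)
  have hka : ∀ s, Integrable fun t => ‖cauchyKernel r (s - t)‖ * ‖cauchyTransform r u t‖ :=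
    fun s => MemLp.integrable_mul (hkL s).norm ha.norm
  -- uniform bound for the inner integrals
  have hbound : ∀ s, ∫ t, ‖cauchyKernel r (s - t)‖ * ‖cauchyTransform r u t‖ ≤
      (∫ t, ‖cauchyKernel r t‖ ^ 2) + ∫ t, ‖cauchyTransform r u t‖ ^ 2 := fun s => by
    have i1 := (memLp_two_iff_integrable_sq_norm (hkL s).1).1 (hkL s)
    have i2 := (memLp_two_iff_integrable_sq_norm ha.1).1 ha
    simp only [Function.comp_def] at i1
    rw [← integral_sub_left_eq_self (fun t => ‖cauchyKernel r t‖ ^ 2) volume s,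
      ← integral_add i1 i2]
    refine integral_mono (hka s) (i1.add i2) fun t => ?_
    nlinarith [sq_nonneg (‖cauchyKernel r (s - t)‖ - ‖cauchyTransform r u t‖),
      sq_nonneg (‖cauchyKernel r (s - t)‖), sq_nonneg ‖cauchyTransform r u t‖]
  have h1 : Integrable (Function.uncurry fun s t : ℝ =>
      inner ℂ (u s) (cauchyKernel r (s - t) • cauchyTransform r u t))
      (volume.prod volume) := by
    have hm : AEStronglyMeasurable (Function.uncurry fun s t : ℝ =>
        inner ℂ (u s) (cauchyKernel r (s - t) • cauchyTransform r u t)) (volume.prod volume) := by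
      refine AEStronglyMeasurable.inner ?_ (AEStronglyMeasurable.smul ?_ ?_)
      · exact (hu.comp continuous_fst).aestronglyMeasurable
      · exact (hk.comp (continuous_fst.sub continuous_snd)).aestronglyMeasurable
      · exact ham.comp_snd
    rw [integrable_prod_iff hm]
    have hle : ∀ s t, ‖inner ℂ (u s) (cauchyKernel r (s - t) • cauchyTransform r u t)‖ ≤
        ‖u s‖ * (‖cauchyKernel r (s - t)‖ * ‖cauchyTransform r u t‖) := fun s t => by
      rw [← norm_smul]; exact norm_inner_le_norm _ _
    have hint : ∀ s, Integrable fun t =>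
        inner ℂ (u s) (cauchyKernel r (s - t) • cauchyTransform r u t) := fun s => by
      refine ((hka s).const_mul ‖u s‖).mono' ?_ (Eventually.of_forall (hle s))
      refine AEStronglyMeasurable.inner aestronglyMeasurable_const
        (AEStronglyMeasurable.smul ?_ ham)
      exact (hk.comp (continuous_const.sub continuous_id)).aestronglyMeasurable
    refine ⟨Eventually.of_forall hint, ?_⟩
    refine (hi.norm.mul_const ((∫ t, ‖cauchyKernel r t‖ ^ 2) +
      ∫ t, ‖cauchyTransform r u t‖ ^ 2)).mono' hm.norm.integral_prod_right'
      (Eventually.of_forall fun s => ?_)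
    rw [Real.norm_of_nonneg (integral_nonneg fun _ => norm_nonneg _)]
    refine (integral_mono (hint s).norm ((hka s).const_mul ‖u s‖) (hle s)).trans ?_
    rw [integral_const_mul]
    exact mul_le_mul_of_nonneg_left (hbound s) (norm_nonneg _)
  have h2 : ∀ s, ∫ t, cauchyKernel r (s - t) • cauchyTransform r u t = 0 := fun s => by
    have h3 : Integrable (Function.uncurry fun s' t : ℝ =>
        cauchyKernel r (s - t) • cauchyKernel r (s' - t) • u s') (volume.prod volume) := by
      have hm : AEStronglyMeasurable (Function.uncurry fun s' t : ℝ =>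
          cauchyKernel r (s - t) • cauchyKernel r (s' - t) • u s') (volume.prod volume) := by
        refine Continuous.aestronglyMeasurable ?_
        simp only [Function.uncurry_def]
        fun_prop
      rw [integrable_prod_iff hm]
      have hkk : ∀ s', Integrable fun t => ‖cauchyKernel r (s - t)‖ * ‖cauchyKernel r (s' - t)‖ :=
        fun s' => MemLp.integrable_mul (hkL s).norm (hkL s').norm
      have hle : ∀ s' t, ‖cauchyKernel r (s - t) • cauchyKernel r (s' - t) • u s'‖ =
        ‖cauchyKernel r (s - t)‖ * ‖cauchyKernel r (s' - t)‖ * ‖u s'‖ := fun s' t => by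
        rw [norm_smul, norm_smul, mul_assoc]
      have hint : ∀ s', Integrable fun t =>
          cauchyKernel r (s - t) • cauchyKernel r (s' - t) • u s' := fun s' => by
        refine ((hkk s').mul_const ‖u s'‖).mono' ?_ (Eventually.of_forall fun t => (hle s' t).le)
        exact Continuous.aestronglyMeasurable (by fun_prop)
      refine ⟨Eventually.of_forall hint, ?_⟩
      refine (hi.norm.const_mul ((∫ t, ‖cauchyKernel r t‖ ^ 2) +
        ∫ t, ‖cauchyKernel r t‖ ^ 2)).mono' hm.norm.integral_prod_right'
        (Eventually.of_forall fun s' => ?_)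
      rw [Real.norm_of_nonneg (integral_nonneg fun _ => norm_nonneg _)]
      simp only [Function.uncurry, hle]
      rw [integral_mul_const]
      refine mul_le_mul_of_nonneg_right ?_ (norm_nonneg _)
      have i1 := fun s : ℝ => (memLp_two_iff_integrable_sq_norm (hkL s).1).1 (hkL s)
      simp only [Function.comp_def] at i1
      nth_rewrite 1 [← integral_sub_left_eq_self (fun t => ‖cauchyKernel r t‖ ^ 2) volume s]
      rw [← integral_sub_left_eq_self (fun t => ‖cauchyKernel r t‖ ^ 2) volume s',
        ← integral_add (i1 s) (i1 s')]
      refine integral_mono (hkk s') ((i1 s).add (i1 s')) fun t => ?_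
      nlinarith [sq_nonneg (‖cauchyKernel r (s - t)‖ - ‖cauchyKernel r (s' - t)‖),
        sq_nonneg (‖cauchyKernel r (s - t)‖), sq_nonneg ‖cauchyKernel r (s' - t)‖]
    calc ∫ t, cauchyKernel r (s - t) • cauchyTransform r u t
        = ∫ t, ∫ s', cauchyKernel r (s - t) • cauchyKernel r (s' - t) • u s' := by
          simp only [cauchyTransform, integral_smul]
      _ = ∫ s', ∫ t, cauchyKernel r (s - t) • cauchyKernel r (s' - t) • u s' :=
          (integral_integral_swap h3).symm
      _ = ∫ s' : ℝ, (0 : X) := by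
          refine integral_congr_ae ?_
          filter_upwards [compl_mem_ae_iff.2 (measure_singleton s)] with s' hs'
          simp only [← mul_smul]
          rw [integral_smul_const, integral_cauchyKernel_mul hr s s' (Ne.symm hs'), zero_smul]
      _ = 0 := by simp
  calc ∫ t, inner ℂ (cauchyTransform (-r) u t) (cauchyTransform r u t)
      = ∫ t, ∫ s, inner ℂ (u s) (cauchyKernel r (s - t) • cauchyTransform r u t) := by
        refine integral_congr_ae (Eventually.of_forall fun t => ?_)
        simp only
        rw [← inner_conj_symm, cauchyTransform.eq_1 (-r), ← integral_inner
          (integrable_cauchyKernel_smul (neg_ne_zero.2 hr) hi t), ← integral_conj]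
        refine integral_congr_ae (Eventually.of_forall fun s => ?_)
        simp only
        rw [inner_conj_symm, inner_smul_left, inner_smul_right, conj_cauchyKernel, neg_neg]
    _ = ∫ s, ∫ t, inner ℂ (u s) (cauchyKernel r (s - t) • cauchyTransform r u t) :=
        (integral_integral_swap h1).symm
    _ = ∫ s : ℝ, (0 : ℂ) := by
        refine integral_congr_ae (Eventually.of_forall fun s => ?_)
        simp only
        rw [integral_inner, h2, inner_zero_right]
        refine memLp_one_iff_integrable.1 ?_
        exact MemLp.smul ha (hkL s)
    _ = 0 := by simp

/-- The Cauchy transform is bounded on `L²`. -/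
theorem eLpNorm_cauchyTransform_le {r : ℝ} (hr : r ≠ 0) {u : ℝ → X} (hu : Continuous u)
    (hi : Integrable u) :
    eLpNorm (cauchyTransform r u) 2 volume ≤
      ENNReal.ofReal (2 * Real.pi) * eLpNorm u 2 volume := by
  have ha := memLp_cauchyTransform hr hu hi
  have hb := memLp_cauchyTransform (neg_ne_zero.2 hr) hu hi
  -- Pythagoras: for orthogonal `a` and `b`, `‖a - b‖² = ‖a‖² + ‖b‖² ≥ ‖a‖²`.
  have key : eLpNorm (cauchyTransform r u) 2 volume ≤
      eLpNorm (cauchyTransform r u - cauchyTransform (-r) u) 2 volume := by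
    have h0 : inner ℂ (ha.toLp) (hb.toLp) = 0 := by
      rw [← inner_conj_symm, L2.inner_def, ← map_zero (starRingEnd ℂ),
        ← integral_inner_cauchyTransform hr hu hi]
      congr 1
      refine integral_congr_ae ?_
      filter_upwards [ha.coeFn_toLp, hb.coeFn_toLp] with t h1 h2
      rw [h1, h2]
    have h1 := norm_sub_sq (𝕜 := ℂ) ha.toLp hb.toLp
    rw [h0, ← MemLp.toLp_sub ha hb, Lp.norm_toLp, Lp.norm_toLp] at h1
    simp only [map_zero, mul_zero, sub_zero] at h1
    rw [← ENNReal.toReal_le_toReal ha.2.ne (ha.sub hb).2.ne]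
    refine (pow_le_pow_iff_left₀ ENNReal.toReal_nonneg ENNReal.toReal_nonneg two_ne_zero).1 ?_
    rw [h1]
    exact le_add_of_nonneg_right (sq_nonneg _)
  refine key.trans ?_
  have hsub : cauchyTransform r u - cauchyTransform (-r) u =
      fun t => ∫ s, (fun x => cauchyKernel r x - cauchyKernel (-r) x) (s - t) • u s := by
    ext t
    rw [Pi.sub_apply, cauchyTransform, cauchyTransform, ← integral_sub
      (integrable_cauchyKernel_smul hr hi t) (integrable_cauchyKernel_smul (neg_ne_zero.2 hr) hi t)]
    simp only [sub_smul]
  rw [hsub]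
  refine (eLpNorm_correlation_le_of_kernel_L1 ((continuous_cauchyKernel hr).sub
    (continuous_cauchyKernel (neg_ne_zero.2 hr))) hu).trans_eq ?_
  congr 1
  have hint : Integrable fun x => cauchyKernel r x - cauchyKernel (-r) x := by
    simp only [cauchyKernel_sub r _ hr]
    exact (((integrable_inv_sq_add_sq hr).const_mul (2 * r)).ofReal).mul_const _
  refine (ofReal_integral_norm_eq_lintegral_enorm hint).symm.trans ?_
  congr 1
  have hn : ∀ x, ‖cauchyKernel r x - cauchyKernel (-r) x‖ = 2 * |r| * (x ^ 2 + r ^ 2)⁻¹ :=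
    fun x => by
      rw [cauchyKernel_sub r x hr, norm_mul, Complex.norm_I, mul_one, Complex.norm_real,
        Real.norm_eq_abs, abs_mul, abs_mul, abs_of_pos (by norm_num : (0 : ℝ) < 2),
        abs_of_nonneg (by positivity : 0 ≤ (x ^ 2 + r ^ 2)⁻¹)]
  simp_rw [hn]
  rw [integral_const_mul, integral_inv_sq_add_sq hr]
  have := abs_pos.2 hr
  field_simp

end CauchyTransform

/-! ### Partial fractions of the cosecant -/

section Cosecant

theorem sum_Icc_neg_eq_add_sum_range {M : Type*} [AddCommMonoid M] (f : ℤ → M) (n : ℕ) :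
    ∑ k ∈ Finset.Icc (-(n : ℤ)) n, f k =
      f 0 + ∑ m ∈ Finset.range n, (f (m + 1) + f (-(m + 1))) := by
  induction n with
  | zero => simp
  | succ n ih =>
    have : Finset.Icc (-((n + 1 : ℕ) : ℤ)) ((n + 1 : ℕ) : ℤ) =
        insert ((n : ℤ) + 1) (insert (-((n : ℤ) + 1)) (Finset.Icc (-(n : ℤ)) n)) := by
      ext k; simp only [Finset.mem_insert, Finset.mem_Icc]; push_cast; omega
    rw [this, Finset.sum_insert, Finset.sum_insert, ih, Finset.sum_range_succ]
    · abel
    · simp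
    · simp; omega

/-- Derived from the cotangent series through `1/sin x = cot(x/2) - cot x`. The terms at even
integers form the cotangent series at `z/2`; the alternating sum is this even part minus the odd
part. -/
theorem hasSum_cosecant {z : ℂ} (hz : z ∈ Complex.integerComplement) :
    HasSum (fun n : ℕ => (-1 : ℂ) ^ (n + 1) * (1 / (z - (n + 1)) + 1 / (z + (n + 1))))
      (Real.pi / Complex.sin (Real.pi * z) - 1 / z) := by
  have hz2 : z / 2 ∈ Complex.integerComplement := by
    rw [Complex.mem_integerComplement_iff] at hz ⊢
    rintro ⟨n, hn⟩
    exact hz ⟨2 * n, by push_cast; rw [hn]; ring⟩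
  set c : ℕ → ℂ := fun n => 1 / (z - (n + 1)) + 1 / (z + (n + 1)) with hc
  have h1 : HasSum c (Real.pi * Complex.cot (Real.pi * z) - 1 / z) := by
    rw [cot_series_rep' hz]
    exact (summable_cotTerm hz).hasSum
  -- The index is shifted by one: `c (2n+1)` belongs to the even integer `2n+2`.
  have h2 : HasSum (fun n => c (2 * n + 1))
      (Real.pi * Complex.cot (Real.pi * (z / 2)) / 2 - 1 / z) := by
    have := (summable_cotTerm hz2).hasSum
    have e : ∑' n, cotTerm (z / 2) n = _ := (cot_series_rep' hz2).symm
    rw [e] at this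
    have := this.div_const 2
    have e1 : (fun n => c (2 * n + 1)) = fun n => cotTerm (z / 2) n / 2 := by
      ext n
      have a1 : z / 2 - (n + 1) = (z - ((2 * n + 1 : ℕ) + 1)) / 2 := by push_cast; ring
      have a2 : z / 2 + (n + 1) = (z + ((2 * n + 1 : ℕ) + 1)) / 2 := by push_cast; ring
      rw [cotTerm, a1, a2, one_div_div, one_div_div]
      simp only [hc]
      ring
    have e2 : Real.pi * Complex.cot (Real.pi * (z / 2)) / 2 - 1 / z =
        (Real.pi * Complex.cot (Real.pi * (z / 2)) - 1 / (z / 2)) / 2 := by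
      rw [one_div_div]; ring
    rw [e1, e2]
    exact this
  have h3 : HasSum (fun n => c (2 * n)) ((Real.pi * Complex.cot (Real.pi * z) - 1 / z) -
      (Real.pi * Complex.cot (Real.pi * (z / 2)) / 2 - 1 / z)) := by
    have hs : Summable fun n => c (2 * n) :=
      h1.summable.comp_injective (mul_right_injective₀ two_ne_zero)
    have := hs.hasSum.even_add_odd h2
    rw [h1.unique this, add_sub_cancel_right]
    exact hs.hasSum
  have h4 := HasSum.even_add_odd (f := fun n => (-1 : ℂ) ^ (n + 1) * c n)
    (by simpa [pow_succ, pow_mul] using h3.neg) (by simpa [pow_succ, pow_mul] using h2)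
  convert h4 using 1
  have hs : Complex.sin (Real.pi * z) ≠ 0 := sin_pi_mul_ne_zero hz
  have hs2 : Complex.sin (Real.pi * (z / 2)) ≠ 0 := sin_pi_mul_ne_zero hz2
  have e1 : (Real.pi : ℂ) * z = 2 * (Real.pi * (z / 2)) := by ring
  rw [e1] at hs ⊢
  rw [Complex.sin_two_mul] at hs
  rw [Complex.cot, Complex.cot, Complex.sin_two_mul, Complex.cos_two_mul]
  have hc0 : Complex.cos (Real.pi * (z / 2)) ≠ 0 := fun h => hs (by rw [h, mul_zero])
  generalize Complex.sin (Real.pi * (z / 2)) = σ at *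
  generalize Complex.cos (Real.pi * (z / 2)) = γ at *
  have : (Real.pi : ℂ) / (2 * σ * γ) =
      Real.pi * (γ / σ) - Real.pi * ((2 * γ ^ 2 - 1) / (2 * σ * γ)) := by
    field_simp; ring
  rw [this]
  ring

theorem tendsto_sum_cosecant {z : ℂ} (hz : z ∈ Complex.integerComplement) :
    Tendsto (fun n : ℕ => ∑ k ∈ Finset.Icc (-(n : ℤ)) n, (-1 : ℂ) ^ k / (z - k)) atTop
      (𝓝 (Real.pi / Complex.sin (Real.pi * z))) := by
  have h := (hasSum_cosecant hz).tendsto_sum_nat.const_add (1 / z)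
  rw [add_sub_cancel] at h
  refine h.congr fun n => ?_
  rw [sum_Icc_neg_eq_add_sum_range]
  congr 1
  · simp
  · refine Finset.sum_congr rfl fun m _ => ?_
    have e : (-1 : ℂ) ^ (-((m : ℤ) + 1)) = (-1) ^ (m + 1) := by
      rw [zpow_neg, ← inv_zpow]; norm_num; exact_mod_cast rfl
    have e' : (-1 : ℂ) ^ ((m : ℤ) + 1) = (-1) ^ (m + 1) := by exact_mod_cast rfl
    rw [e, e']
    push_cast
    rw [sub_neg_eq_add]
    ring

end Cosecant

/-! ### Sinc series of the Cauchy kernel -/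

section Sinc

theorem Sinc_eq {θ t : ℝ} (hθ : θ ≠ 0) (k : ℤ) (h : t ≠ k * θ) :
    Sinc k θ t = Real.sin (Real.pi * t / θ) * (θ / Real.pi) * ((-1) ^ k / (t - k * θ)) := by
  have hx : Real.pi * (t - k * θ) / θ ≠ 0 :=
    div_ne_zero (mul_ne_zero Real.pi_ne_zero (sub_ne_zero.2 h)) hθ
  have e : Real.pi * (t - k * θ) / θ = Real.pi * t / θ - k * Real.pi := by
    field_simp
  rw [Sinc, Real.sinc_of_ne_zero hx]
  nth_rewrite 1 [e]
  rw [Real.sin_sub_int_mul_pi]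
  have := sub_ne_zero.2 h
  have := Real.pi_ne_zero
  field_simp

/-- Each term is `sin(πt/θ)` times `(-1)^k / ((t - kθ)(w - kθ))`. Splitting this into partial
fractions leaves the difference of the cosecant series at `t/θ` and at `w/θ`. -/
theorem tendsto_sum_Sinc_div {θ t : ℝ} (hθ : 0 < θ) (ht : ∀ k : ℤ, t ≠ k * θ) {w : ℂ}
    (hw : w.im ≠ 0) :
    Tendsto (fun n : ℕ => ∑ k ∈ Finset.Icc (-(n : ℤ)) n, (Sinc k θ t : ℂ) * (w - (k * θ : ℝ))⁻¹)
      atTop (𝓝 ((1 - Real.sin (Real.pi * t / θ) / Complex.sin (Real.pi * w / θ)) * (w - t)⁻¹)) := by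
  have hθ' : (θ : ℂ) ≠ 0 := by exact_mod_cast hθ.ne'
  have h1 : (t / θ : ℂ) ∈ Complex.integerComplement := by
    rw [Complex.mem_integerComplement_iff]
    rintro ⟨k, hk⟩
    rw [eq_div_iff hθ'] at hk
    exact ht k (by exact_mod_cast hk.symm)
  have h2 : w / θ ∈ Complex.integerComplement := by
    rw [Complex.mem_integerComplement_iff]
    rintro ⟨k, hk⟩
    rw [eq_div_iff hθ'] at hk
    apply hw
    rw [← hk]; simp
  have hwr : ∀ x : ℝ, w - x ≠ 0 := fun x h => hw (by
    rw [sub_eq_zero.1 h]; simp)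
  have htk : ∀ k : ℤ, (t : ℂ) - k * θ ≠ 0 := fun k h => ht k (by exact_mod_cast sub_eq_zero.1 h)
  have hs : Complex.sin (Real.pi * (t / θ)) ≠ 0 := sin_pi_mul_ne_zero h1
  have h := ((tendsto_sum_cosecant h1).sub (tendsto_sum_cosecant h2)).const_mul
    (Complex.sin (Real.pi * (t / θ)) / Real.pi * (w - t)⁻¹)
  have hpi : (Real.pi : ℂ) ≠ 0 := by exact_mod_cast Real.pi_ne_zero
  convert h using 1
  · ext n
    rw [← Finset.sum_sub_distrib, Finset.mul_sum]
    refine Finset.sum_congr rfl fun k _ => ?_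
    rw [Sinc_eq hθ.ne' k (ht k)]
    have a1 := htk k
    have a2 := hwr (k * θ)
    have a3 := hwr t
    push_cast at a2 ⊢
    have e1 : (t : ℂ) / θ - k = (t - k * θ) / θ := by field_simp
    have e2 : w / θ - k = (w - k * θ) / θ := by field_simp
    have key : ((t : ℂ) - k * θ)⁻¹ * (w - k * θ)⁻¹ =
        (((t : ℂ) - k * θ)⁻¹ - (w - k * θ)⁻¹) * (w - t)⁻¹ := by
      rw [inv_sub_inv a1 a2]; field_simp; ring
    rw [e1, e2, mul_div_assoc]
    simp only [div_eq_mul_inv, mul_inv, inv_inv]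
    linear_combination (Complex.sin (Real.pi * (t * (θ : ℂ)⁻¹)) * (θ * (Real.pi : ℂ)⁻¹) *
      (-1) ^ k) * key
  · congr 1
    push_cast
    rw [← mul_div_assoc, ← mul_div_assoc]
    rw [← mul_div_assoc] at hs
    have hs2 : Complex.sin (Real.pi * w / θ) ≠ 0 := by
      rw [mul_div_assoc]; exact sin_pi_mul_ne_zero h2
    have a3 := hwr t
    field_simp

theorem sinc_sq_le (x : ℝ) : Real.sinc x ^ 2 ≤ 2 * (x ^ 2 + 1)⁻¹ := by
  rw [← div_eq_mul_inv, le_div_iff₀ (by positivity)]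
  have h1 : Real.sinc x ^ 2 ≤ 1 := by
    rw [← sq_abs]; exact pow_le_one₀ (abs_nonneg _) (Real.abs_sinc_le_one x)
  have h2 : Real.sinc x ^ 2 * x ^ 2 ≤ 1 := by
    rcases eq_or_ne x 0 with rfl | hx
    · simp
    · rw [Real.sinc_of_ne_zero hx, div_pow, div_mul_cancel₀ _ (by positivity)]
      exact Real.sin_sq_le_one x
  linarith

theorem Sinc_sq_le {θ : ℝ} (hθ : 0 < θ) (k : ℤ) (t : ℝ) :
    Sinc k θ t ^ 2 ≤ 2 * (θ / Real.pi) ^ 2 * ((t - k * θ) ^ 2 + (θ / Real.pi) ^ 2)⁻¹ := by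
  refine (sinc_sq_le _).trans_eq ?_
  have := Real.pi_pos
  have : 0 < (t - k * θ) ^ 2 + (θ / Real.pi) ^ 2 := by positivity
  rw [mul_assoc, ← div_eq_mul_inv ((θ / Real.pi) ^ 2)]
  congr 1
  rw [inv_eq_one_div, div_eq_div_iff (by positivity) (by positivity)]
  field_simp

theorem continuous_Sinc (k : ℤ) (θ : ℝ) : Continuous (Sinc k θ) := by
  unfold Sinc
  exact Real.continuous_sinc.comp (by fun_prop)

/-- The majorant `2/(x² + 1)` of `sinc²` has an elementary integral; the resulting factor `√2` is
harmless. -/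
theorem eLpNorm_Sinc_le {θ : ℝ} (hθ : 0 < θ) (k : ℤ) :
    eLpNorm (Sinc k θ) 2 volume ≤ ENNReal.ofReal √(2 * θ) := by
  apply eLpNorm_two_le
  have hp : θ / Real.pi ≠ 0 := (div_pos hθ Real.pi_pos).ne'
  have hi := ((integrable_inv_sq_add_sq hp).comp_sub_right (k * θ)).const_mul
    (2 * (θ / Real.pi) ^ 2)
  calc ∫⁻ t, ‖Sinc k θ t‖ₑ ^ 2
      ≤ ∫⁻ t, ENNReal.ofReal
        (2 * (θ / Real.pi) ^ 2 * ((t - k * θ) ^ 2 + (θ / Real.pi) ^ 2)⁻¹) := by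
        refine lintegral_mono fun t => ?_
        rw [Real.enorm_eq_ofReal_abs, ← ENNReal.ofReal_pow (abs_nonneg _), sq_abs]
        exact ENNReal.ofReal_le_ofReal (Sinc_sq_le hθ k t)
    _ = ENNReal.ofReal (2 * θ) := by
        rw [← ofReal_integral_eq_lintegral_ofReal hi (Eventually.of_forall fun t => by positivity),
          integral_const_mul,
          integral_sub_right_eq_self (fun t => (t ^ 2 + (θ / Real.pi) ^ 2)⁻¹),
          integral_inv_sq_add_sq hp, abs_of_pos (div_pos hθ Real.pi_pos)]
        congr 1
        have := Real.pi_pos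
        field_simp
    _ = _ := by
        rw [← ENNReal.ofReal_pow (Real.sqrt_nonneg _), Real.sq_sqrt (by positivity)]

theorem summable_inv_one_add_int_sq : Summable fun j : ℤ => (1 + (j : ℝ) ^ 2)⁻¹ := by
  refine Summable.of_norm_bounded_eventually
    (Real.summable_one_div_int_pow.2 (by norm_num : 1 < 2)) ?_
  filter_upwards [(Set.finite_singleton (0 : ℤ)).compl_mem_cofinite] with j hj
  have hj : j ≠ 0 := hj
  have hj' : (0 : ℝ) < (j : ℝ) ^ 2 := by positivity
  rw [Real.norm_of_nonneg (by positivity), one_div]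
  exact inv_anti₀ hj' (by linarith)

/-- Uniformity in `s` is the point, as the bound serves as an integrable majorant. It comes from
recentring the sum at the node index `⌊s/θ⌋`. -/
theorem exists_forall_sum_inv_sq_le {θ r : ℝ} (hθ : 0 < θ) (hr : r ≠ 0) :
    ∃ M : ℝ, ∀ (s : ℝ) (S : Finset ℤ), ∑ k ∈ S, ((s - k * θ) ^ 2 + r ^ 2)⁻¹ ≤ M := by
  -- With `v = s/θ - k` one has `1 + (k - m)² ≤ 2v² + 3`; the coefficient `2/θ²` absorbs `2v²` and
  -- `3/r²` absorbs `3`.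
  refine ⟨(2 / θ ^ 2 + 3 / r ^ 2) * ∑' j : ℤ, (1 + (j : ℝ) ^ 2)⁻¹, fun s S => ?_⟩
  set m : ℤ := ⌊s / θ⌋
  have hr2 : 0 < r ^ 2 := by positivity
  have h1 : ∀ k : ℤ, ((s - k * θ) ^ 2 + r ^ 2)⁻¹ ≤
      (2 / θ ^ 2 + 3 / r ^ 2) * (1 + ((k - m : ℤ) : ℝ) ^ 2)⁻¹ := fun k => by
    rw [← div_eq_mul_inv, inv_eq_one_div, div_le_div_iff₀ (by positivity) (by positivity)]
    set v := s / θ - k with hv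
    have hs : s - k * θ = θ * v := by rw [hv]; field_simp
    have hm1 : (m : ℝ) ≤ s / θ := Int.floor_le _
    have hm2 : s / θ < m + 1 := Int.lt_floor_add_one _
    have h3 : (((k - m : ℤ) : ℝ)) ^ 2 ≤ 2 * v ^ 2 + 2 := by
      push_cast
      have e : (k - m : ℝ) = (s / θ - m) - v := by rw [hv]; ring
      rw [e]
      nlinarith [sq_nonneg ((s / θ - m) + v), sq_nonneg v]
    have h4 : (2 / θ ^ 2 + 3 / r ^ 2) * ((s - k * θ) ^ 2 + r ^ 2) =
      2 * v ^ 2 + 3 + (2 * r ^ 2 / θ ^ 2 + 3 * (θ * v) ^ 2 / r ^ 2) := by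
      rw [hs]; field_simp; ring
    have h5 : 0 ≤ 2 * r ^ 2 / θ ^ 2 + 3 * (θ * v) ^ 2 / r ^ 2 := by positivity
    rw [h4]; linarith
  calc _ ≤ ∑ k ∈ S, (2 / θ ^ 2 + 3 / r ^ 2) * (1 + ((k - m : ℤ) : ℝ) ^ 2)⁻¹ :=
        Finset.sum_le_sum fun k _ => h1 k
    _ = (2 / θ ^ 2 + 3 / r ^ 2) * ∑ k ∈ S, (1 + ((k - m : ℤ) : ℝ) ^ 2)⁻¹ := by
        rw [Finset.mul_sum]
    _ ≤ (2 / θ ^ 2 + 3 / r ^ 2) * ∑' k : ℤ, (1 + ((k - m : ℤ) : ℝ) ^ 2)⁻¹ := by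
        refine mul_le_mul_of_nonneg_left ?_ (by positivity)
        refine Summable.sum_le_tsum S (fun _ _ => by positivity) ?_
        exact summable_inv_one_add_int_sq.comp_injective (sub_left_injective)
    _ = _ := by
        rw [← (Equiv.subRight m).tsum_eq (fun j : ℤ => (1 + (j : ℝ) ^ 2)⁻¹)]
        rfl

/-- The inequality `ab ≤ a² + b²` reduces the sum to two lattice sums of inverse squares. -/
theorem exists_forall_norm_sum_Sinc_div_le {θ r : ℝ} (hθ : 0 < θ) (hr : r ≠ 0) (t : ℝ) :
    ∃ M : ℝ, ∀ (s : ℝ) (S : Finset ℤ),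
      ‖∑ k ∈ S, (Sinc k θ t : ℂ) * cauchyKernel r (s - k * θ)‖ ≤ M := by
  obtain ⟨M₁, h₁⟩ := exists_forall_sum_inv_sq_le hθ hr
  obtain ⟨M₂, h₂⟩ := exists_forall_sum_inv_sq_le hθ (div_pos hθ Real.pi_pos).ne'
  refine ⟨2 * (θ / Real.pi) ^ 2 * M₂ + M₁, fun s S => ?_⟩
  calc _ ≤ ∑ k ∈ S, ‖(Sinc k θ t : ℂ) * cauchyKernel r (s - k * θ)‖ := norm_sum_le _ _
    _ ≤ ∑ k ∈ S, (2 * (θ / Real.pi) ^ 2 * ((t - k * θ) ^ 2 + (θ / Real.pi) ^ 2)⁻¹ +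
        ((s - k * θ) ^ 2 + r ^ 2)⁻¹) := by
        refine Finset.sum_le_sum fun k _ => ?_
        rw [norm_mul, Complex.norm_real, Real.norm_eq_abs, ← norm_cauchyKernel_sq r (s - k * θ)]
        have := Sinc_sq_le hθ k t
        rw [← sq_abs] at this
        nlinarith [sq_nonneg (|Sinc k θ t| - ‖cauchyKernel r (s - k * θ)‖),
          sq_nonneg |Sinc k θ t|, sq_nonneg ‖cauchyKernel r (s - k * θ)‖]
    _ ≤ _ := by
        rw [Finset.sum_add_distrib, ← Finset.mul_sum]
        exact add_le_add (mul_le_mul_of_nonneg_left (h₂ t S) (by positivity)) (h₁ s S)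

end Sinc

/-- The open horizontal strip `|Im w| < d`. -/
def strip (d : ℝ) : Set ℂ := {w : ℂ | |w.im| < d}

theorem isOpen_strip (d : ℝ) : IsOpen (strip d) :=
  isOpen_lt (Complex.continuous_im.abs) continuous_const

theorem add_mul_I_mem_strip {d y : ℝ} (hy : |y| < d) (x : ℝ) :
    (x : ℂ) + y * Complex.I ∈ strip d := by
  simpa [strip] using hy

theorem ofReal_mem_strip {d : ℝ} (hd : 0 < d) (x : ℝ) : (x : ℂ) ∈ strip d := by
  simpa [strip] using hd

/-! ### Choice of abscissas -/

section Sequence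

/-- By Markov's inequality `{W ≥ 1}` has finite measure, so it and its reflection cannot cover a
half line. This supplies both vertical sides of the contour at once. -/
theorem exists_gt_le_one_of_lintegral_ne_top {W : ℝ → ℝ≥0∞} (hW : AEMeasurable W volume)
    (h : ∫⁻ x, W x ≠ ∞) (n : ℝ) : ∃ R > n, W R ≤ 1 ∧ W (-R) ≤ 1 := by
  by_contra! hc
  have h1 : volume {x | 1 ≤ W x} < ∞ := by
    have := mul_meas_ge_le_lintegral₀ hW 1
    rw [one_mul] at this
    exact this.trans_lt h.lt_top
  have h2 : Set.Ioi n ⊆ {x | 1 ≤ W x} ∪ Neg.neg ⁻¹' {x | 1 ≤ W x} := fun R hR => by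
    by_cases hw : 1 ≤ W R
    · exact Or.inl hw
    · exact Or.inr (hc R hR (not_le.1 hw).le).le
  have h3 := (measure_mono (μ := volume) h2).trans (measure_union_le _ _)
  rw [Measure.measure_preimage_neg, Real.volume_Ioi] at h3
  exact absurd h3 (not_le.2 (ENNReal.add_lt_top.2 ⟨h1, h1⟩))

end Sequence

/-! ### Cauchy's formula in the strip -/

section CauchyFormula

variable {X : Type*} [NormedAddCommGroup X] [InnerProductSpace ℂ X]

theorem continuous_comp_line {d y : ℝ} {G : ℂ → X} (hG : DifferentiableOn ℂ G (strip d))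
    (hy : |y| < d) : Continuous fun s : ℝ => G (s + y * Complex.I) :=
  hG.continuousOn.comp_continuous (by fun_prop) (add_mul_I_mem_strip hy)

theorem dslope_line {G : ℂ → X} {y : ℝ} (hy : y ≠ 0) (t x : ℝ) :
    dslope G t (x + y * Complex.I) =
      cauchyKernel (-y) (x - t) • (G (x + y * Complex.I) - G t) := by
  rw [dslope_of_ne _ (fun h => hy (by simpa using congrArg Complex.im h)), slope_def_module]
  rw [cauchyKernel]
  congr 2
  push_cast; ring

/-- The difference quotient carries a factor `1/(|a| - |t|)`, so a mere bound on the integral of `G`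
over the side makes its contribution vanish as `|a| → ∞`. -/
theorem enorm_integral_dslope_vertical_le {G : ℂ → X} {r : ℝ} (hr : 0 < r) {t a : ℝ}
    (ha : |t| < |a|) (hW : ∫⁻ y in Set.Ioc (-r) r, ‖G (a + y * Complex.I)‖ₑ ≤ 1) :
    ‖∫ y in (-r)..r, dslope G t (a + y * Complex.I)‖ₑ ≤
      ENNReal.ofReal (|a| - |t|)⁻¹ * (1 + ‖G t‖ₑ * ENNReal.ofReal (2 * r)) := by
  rw [intervalIntegral.integral_of_le (by linarith)]
  refine (enorm_integral_le_lintegral_enorm _).trans ?_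
  have h1 : ∀ y : ℝ, ‖dslope G t (a + y * Complex.I)‖ₑ ≤
      ENNReal.ofReal (|a| - |t|)⁻¹ * (‖G (a + y * Complex.I)‖ₑ + ‖G t‖ₑ) := fun y => by
    have hle : |a| - |t| ≤ ‖(a : ℂ) + y * Complex.I - t‖ := by
      refine (abs_sub_abs_le_abs_sub a t).trans ?_
      simpa using Complex.abs_re_le_norm ((a : ℂ) + y * Complex.I - t)
    have hpos : 0 < |a| - |t| := sub_pos.2 ha
    have hne : (a : ℂ) + y * Complex.I ≠ t := fun h => by
      rw [h, sub_self, norm_zero] at hle; linarith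
    rw [dslope_of_ne _ hne, slope_def_module, enorm_smul]
    refine mul_le_mul' ?_ (enorm_sub_le)
    rw [← ofReal_norm, norm_inv]
    exact ENNReal.ofReal_le_ofReal (inv_anti₀ hpos hle)
  refine (lintegral_mono h1).trans ?_
  rw [lintegral_const_mul' _ _ ENNReal.ofReal_ne_top]
  refine mul_le_mul_right ?_ _
  rw [lintegral_add_right _ measurable_const]
  refine add_le_add hW ?_
  rw [setLIntegral_const, Real.volume_Ioc]
  exact le_of_eq (by congr 2; ring)

variable [CompleteSpace X]

/-- Cauchy's theorem is applied on rectangles to `(G(w) - G(t))/(w - t)`, which is holomorphic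
across `t`, so no residue is computed. The subtracted `G(t)` contributes the integral of the kernel
jump, which is `2πi`. -/
theorem cauchy_formula_strip {d r : ℝ} (hr : 0 < r) (hrd : r < d) {G : ℂ → X}
    (hG : DifferentiableOn ℂ G (strip d))
    (hi : ∀ y ∈ ({r, -r} : Set ℝ), Integrable fun s : ℝ => G (s + y * Complex.I))
    (hW : ∀ n : ℝ, ∃ R > n, ∫⁻ y in Set.Ioc (-r) r, ‖G (R + y * Complex.I)‖ₑ ≤ 1 ∧
      ∫⁻ y in Set.Ioc (-r) r, ‖G ((-R : ℝ) + y * Complex.I)‖ₑ ≤ 1) (t : ℝ) :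
    (2 * Real.pi * Complex.I : ℂ) • G t =
      cauchyTransform r (fun s => G (s + (-r : ℝ) * Complex.I)) t -
        cauchyTransform (-r) (fun s => G (s + r * Complex.I)) t := by
  have hr0 := hr.ne'
  have hr0' := neg_ne_zero.2 hr0
  have ip := hi r (by simp)
  have im := hi (-r) (by simp)
  choose R hR hR1 hR2 using fun n : ℕ => hW (n + |t| + 1)
  have hRt : ∀ n, |t| < |R n| := fun n => by
    have := hR n
    have h0 : (0 : ℝ) ≤ n := n.cast_nonneg
    have := le_abs_self (R n)
    linarith
  have hRpos : ∀ n, 0 < R n := fun n => by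
    have := hR n
    have h0 : (0 : ℝ) ≤ n := n.cast_nonneg
    have := abs_nonneg t
    linarith
  have hRlim : Tendsto R atTop atTop :=
    tendsto_atTop_mono (fun n => by have := hR n; have := abs_nonneg t; linarith)
      tendsto_natCast_atTop_atTop
  -- The difference quotient on the lower line minus that on the upper one. The terms in `G t` are
  -- combined because only the jump of the kernel is integrable.
  set h : ℝ → X := fun x => cauchyKernel r (x - t) • G (x + (-r : ℝ) * Complex.I) -
    cauchyKernel (-r) (x - t) • G (x + r * Complex.I) -
    (cauchyKernel r (x - t) - cauchyKernel (-r) (x - t)) • G t with hh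
  have i1 := integrable_cauchyKernel_smul hr0 im t
  have i2 := integrable_cauchyKernel_smul hr0' ip t
  have hk : Integrable fun x => cauchyKernel r x - cauchyKernel (-r) x := by
    simp only [cauchyKernel_sub r _ hr0]
    exact (((integrable_inv_sq_add_sq hr0).const_mul (2 * r)).ofReal).mul_const _
  have i3 : Integrable fun x => (cauchyKernel r (x - t) - cauchyKernel (-r) (x - t)) • G t :=
    (hk.comp_sub_right t).smul_const _
  have hint : Integrable h := (i1.sub i2).sub i3
  have hval : ∫ x, h x = cauchyTransform r (fun s => G (s + (-r : ℝ) * Complex.I)) t -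
      cauchyTransform (-r) (fun s => G (s + r * Complex.I)) t -
      (2 * Real.pi * Complex.I : ℂ) • G t := by
    have e : ∫ x, h x = (∫ x, (cauchyKernel r (x - t) • G (x + (-r : ℝ) * Complex.I) -
        cauchyKernel (-r) (x - t) • G (x + r * Complex.I))) -
        ∫ x, (cauchyKernel r (x - t) - cauchyKernel (-r) (x - t)) • G t :=
      integral_sub (i1.sub i2) i3
    rw [e, integral_sub i1 i2, integral_smul_const,
      integral_sub_right_eq_self (fun x => cauchyKernel r x - cauchyKernel (-r) x)]
    congr 2
    simp only [cauchyKernel_sub r _ hr0]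
    rw [integral_mul_const, integral_complex_ofReal, integral_const_mul,
      integral_inv_sq_add_sq hr0, abs_of_pos hr]
    congr 1
    push_cast
    have : (r : ℂ) ≠ 0 := by exact_mod_cast hr0
    field_simp
  have hds : DifferentiableOn ℂ (dslope G t) (strip d) :=
    (Complex.differentiableOn_dslope ((isOpen_strip d).mem_nhds
      (ofReal_mem_strip (hr.trans hrd) t))).2 hG
  have hrect : ∀ n, ∫ x in (-R n)..(R n), h x =
      Complex.I • (∫ y in (-r)..r, dslope G t ((-R n : ℝ) + y * Complex.I)) -
      Complex.I • (∫ y in (-r)..r, dslope G t (R n + y * Complex.I)) := fun n => by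
    have hsub : Set.uIcc (-R n) (R n) ×ℂ Set.uIcc (-r) r ⊆ strip d := fun w hw => by
      have h2 := (Complex.mem_reProdIm.1 hw).2
      rw [Set.uIcc_of_le (by linarith)] at h2
      exact (abs_le.2 h2).trans_lt hrd
    have := Complex.integral_boundary_rect_eq_zero_of_differentiableOn (dslope G t)
      ⟨-R n, -r⟩ ⟨R n, r⟩ (hds.mono hsub)
    simp only at this
    have e : ∫ x in (-R n)..(R n), h x =
        (∫ x in (-R n)..(R n), dslope G t (x + (-r : ℝ) * Complex.I)) -
        ∫ x in (-R n)..(R n), dslope G t (x + r * Complex.I) := by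
      rw [← intervalIntegral.integral_sub]
      · refine intervalIntegral.integral_congr fun x _ => ?_
        simp only [hh]
        rw [dslope_line hr0', dslope_line hr0, neg_neg, smul_sub, smul_sub, sub_smul]
        abel
      · exact (continuous_comp_line hds (by rwa [abs_neg, abs_of_pos hr])).intervalIntegrable _ _
      · exact (continuous_comp_line hds (by rwa [abs_of_pos hr])).intervalIntegrable _ _
    rw [e]
    rw [sub_eq_zero, add_comm, ← eq_sub_iff_add_eq'] at this
    exact this
  have hlim := intervalIntegral_tendsto_integral hint (tendsto_neg_atTop_atBot.comp hRlim) hRlim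
  have hzero : Tendsto (fun n => ∫ x in (-R n)..(R n), h x) atTop (𝓝 0) := by
    rw [tendsto_zero_iff_enorm_tendsto_zero]
    have hI : ‖Complex.I‖ₑ = 1 := by rw [← ofReal_norm, Complex.norm_I, ENNReal.ofReal_one]
    have hb : ∀ n, ‖∫ x in (-R n)..(R n), h x‖ₑ ≤
        2 * (ENNReal.ofReal (|R n| - |t|)⁻¹ * (1 + ‖G t‖ₑ * ENNReal.ofReal (2 * r))) := fun n => by
      rw [hrect n, two_mul]
      refine enorm_sub_le.trans (add_le_add ?_ ?_)
      · rw [enorm_smul, hI, one_mul]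
        have := enorm_integral_dslope_vertical_le hr (t := t) (a := -R n)
          (by rw [abs_neg]; exact hRt n) (hR2 n)
        rwa [abs_neg] at this
      · rw [enorm_smul, hI, one_mul]
        exact enorm_integral_dslope_vertical_le hr (hRt n) (hR1 n)
    refine tendsto_of_tendsto_of_tendsto_of_le_of_le tendsto_const_nhds ?_ (fun _ => zero_le) hb
    have h1 : Tendsto (fun n => |R n| - |t|) atTop atTop :=
      tendsto_atTop_add_const_right _ _ (tendsto_abs_atTop_atTop.comp hRlim)
    have h2 := ENNReal.tendsto_ofReal (tendsto_inv_atTop_zero.comp h1)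
    rw [ENNReal.ofReal_zero] at h2
    have hc : 1 + ‖G t‖ₑ * ENNReal.ofReal (2 * r) ≠ ∞ :=
      ENNReal.add_ne_top.2 ⟨ENNReal.one_ne_top, ENNReal.mul_ne_top enorm_ne_top ENNReal.ofReal_ne_top⟩
    have h3 := ENNReal.Tendsto.const_mul (a := 2)
      (ENNReal.Tendsto.mul_const (b := 1 + ‖G t‖ₑ * ENNReal.ofReal (2 * r)) h2 (Or.inr hc))
      (Or.inr (by simp))
    simpa using h3
  have := tendsto_nhds_unique hlim hzero
  rw [hval, sub_eq_zero] at this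
  exact this.symm

end CauchyFormula

/-! ### Discretization error of the sinc series -/

section Discretization

theorem abs_sinh_im_le_norm_sin (z : ℂ) : |Real.sinh z.im| ≤ ‖Complex.sin z‖ := by
  rw [← abs_norm, ← sq_le_sq, ← Complex.normSq_eq_norm_sq]
  have : Complex.sin z = (Real.sin z.re * Real.cosh z.im : ℝ) +
      (Real.cos z.re * Real.sinh z.im : ℝ) * Complex.I := by
    conv_lhs => rw [← Complex.re_add_im z, Complex.sin_add_mul_I]
    push_cast; ring
  rw [this, Complex.normSq_add_mul_I]
  nlinarith [Real.sin_sq_add_cos_sq z.re, Real.cosh_sq z.im, sq_nonneg (Real.sin z.re)]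

theorem norm_inv_sin_line_le {θ : ℝ} (hθ : 0 < θ) {y : ℝ} (hy : y ≠ 0) (s : ℝ) :
    ‖(Complex.sin (Real.pi * (s - y * Complex.I) / θ))⁻¹‖ ≤ (Real.sinh (Real.pi * |y| / θ))⁻¹ := by
  rw [norm_inv]
  refine inv_anti₀ (Real.sinh_pos_iff.2 (by have := Real.pi_pos; have := abs_pos.2 hy; positivity)) ?_
  refine le_trans (le_of_eq ?_) (abs_sinh_im_le_norm_sin _)
  have e : (Real.pi * ((s : ℂ) - y * Complex.I) / θ) =
      (Real.pi * s / θ : ℝ) + (-(Real.pi * y / θ) : ℝ) * Complex.I := by push_cast; ring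
  have e2 : (Real.pi * ((s : ℂ) - y * Complex.I) / θ).im = -(Real.pi * y / θ) := by
    rw [e, Complex.add_im, Complex.ofReal_im, Complex.mul_im]; simp
  rw [e2, Real.sinh_neg, abs_neg, Real.abs_sinh, abs_div, abs_mul, abs_of_pos hθ,
    abs_of_pos Real.pi_pos]

theorem sin_line_ne_zero {θ : ℝ} (hθ : 0 < θ) {y : ℝ} (hy : y ≠ 0) (s : ℝ) :
    Complex.sin (Real.pi * (s - y * Complex.I) / θ) ≠ 0 := by
  have h := abs_sinh_im_le_norm_sin (Real.pi * (s - y * Complex.I) / θ)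
  intro h0
  have e : (Real.pi * ((s : ℂ) - y * Complex.I) / θ) =
      (Real.pi * s / θ : ℝ) + (-(Real.pi * y / θ) : ℝ) * Complex.I := by push_cast; ring
  have e2 : (Real.pi * ((s : ℂ) - y * Complex.I) / θ).im = -(Real.pi * y / θ) := by
    rw [e, Complex.add_im, Complex.ofReal_im, Complex.mul_im]; simp
  rw [h0, norm_zero, e2] at h
  have h1 := abs_nonpos_iff.1 h
  rw [Real.sinh_eq_zero, neg_eq_zero, div_eq_zero_iff, mul_eq_zero] at h1
  rcases h1 with (h1 | h1) | h1
  · exact Real.pi_ne_zero h1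
  · exact hy h1
  · exact hθ.ne' h1

variable {X : Type*} [NormedAddCommGroup X] [InnerProductSpace ℂ X]

/-- The function `s ↦ u(s) / sin (π (s - i y) / θ)`. -/
noncomputable def divSin (θ y : ℝ) (u : ℝ → X) (s : ℝ) : X :=
  (Complex.sin (Real.pi * (s - y * Complex.I) / θ))⁻¹ • u s

theorem continuous_divSin {θ : ℝ} (hθ : 0 < θ) {y : ℝ} (hy : y ≠ 0) {u : ℝ → X}
    (hu : Continuous u) : Continuous (divSin θ y u) := by
  unfold divSin
  exact (Continuous.inv₀ (by fun_prop) (sin_line_ne_zero hθ hy)).smul hu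

theorem norm_divSin_le {θ : ℝ} (hθ : 0 < θ) {y : ℝ} (hy : y ≠ 0) (u : ℝ → X) (s : ℝ) :
    ‖divSin θ y u s‖ ≤ (Real.sinh (Real.pi * |y| / θ))⁻¹ * ‖u s‖ := by
  rw [divSin, norm_smul]
  exact mul_le_mul_of_nonneg_right (norm_inv_sin_line_le hθ hy s) (norm_nonneg _)

theorem integrable_divSin {θ : ℝ} (hθ : 0 < θ) {y : ℝ} (hy : y ≠ 0) {u : ℝ → X}
    (hu : Continuous u) (hi : Integrable u) : Integrable (divSin θ y u) :=
  (hi.norm.const_mul _).mono' (continuous_divSin hθ hy hu).aestronglyMeasurable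
    (Eventually.of_forall (norm_divSin_le hθ hy u))

theorem eLpNorm_divSin_le {θ : ℝ} (hθ : 0 < θ) {y : ℝ} (hy : y ≠ 0) (u : ℝ → X) :
    eLpNorm (divSin θ y u) 2 volume ≤
      ENNReal.ofReal (Real.sinh (Real.pi * |y| / θ))⁻¹ * eLpNorm u 2 volume :=
  eLpNorm_le_mul_eLpNorm_of_ae_le_mul (Eventually.of_forall (norm_divSin_le hθ hy u)) 2

theorem cauchyKernel_sub_eq (y s x : ℝ) :
    cauchyKernel y (s - x) = (((s : ℂ) - y * Complex.I) - x)⁻¹ := by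
  rw [cauchyKernel]; congr 1; push_cast; ring

/-- The sinc series `∑_{|k| ≤ K} g(kθ) Sinc(k, θ)`. -/
noncomputable def sincSum (θ : ℝ) (K : ℕ) (g : ℝ → X) (t : ℝ) : X :=
  ∑ k ∈ Finset.Icc (-(K : ℤ)) K, Sinc k θ t • g (k * θ)

theorem continuous_sincSum (θ : ℝ) (K : ℕ) (g : ℝ → X) : Continuous (sincSum θ K g) := by
  unfold sincSum
  exact continuous_finsetSum _ fun k _ => (continuous_Sinc k θ).smul continuous_const

/-- The kernel identity is integrated against `u`; the uniform bound on its partial sums justifies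
dominated convergence. -/
theorem tendsto_cauchyTransform_sub_sincSum {θ : ℝ} (hθ : 0 < θ) {y : ℝ} (hy : y ≠ 0) {u : ℝ → X}
    (hu : Continuous u) (hi : Integrable u) {t : ℝ} (ht : ∀ k : ℤ, t ≠ k * θ) :
    Tendsto (fun n : ℕ => cauchyTransform y u t - sincSum θ n (cauchyTransform y u) t) atTop
      (𝓝 (Real.sin (Real.pi * t / θ) • cauchyTransform y (divSin θ y u) t)) := by
  obtain ⟨M, hM⟩ := exists_forall_norm_sum_Sinc_div_le hθ hy t
  set c : ℕ → ℝ → ℂ := fun n s => cauchyKernel y (s - t) -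
    ∑ k ∈ Finset.Icc (-(n : ℤ)) n, (Sinc k θ t : ℂ) * cauchyKernel y (s - k * θ) with hc
  have hk := continuous_cauchyKernel hy
  have hcc : ∀ n, Continuous (c n) := fun n => by
    simp only [hc]; fun_prop
  have e1 : ∀ n : ℕ, cauchyTransform y u t - sincSum θ n (cauchyTransform y u) t =
      ∫ s, c n s • u s := fun n => by
    simp only [hc, sub_smul, Finset.sum_smul]
    rw [integral_sub (integrable_cauchyKernel_smul hy hi t), integral_finsetSum]
    · simp only [sincSum, cauchyTransform, mul_smul, integral_smul, Complex.coe_smul]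
    · intro k _
      simp only [mul_smul]
      exact (integrable_cauchyKernel_smul hy hi _).smul (Sinc k θ t : ℂ)
    · refine integrable_finsetSum _ fun k _ => ?_
      simp only [mul_smul]
      exact (integrable_cauchyKernel_smul hy hi _).smul (Sinc k θ t : ℂ)
  have e2 : Real.sin (Real.pi * t / θ) • cauchyTransform y (divSin θ y u) t =
      ∫ s : ℝ, ((Real.sin (Real.pi * t / θ) / Complex.sin (Real.pi * (s - y * Complex.I) / θ)) *
        cauchyKernel y (s - t)) • u s := by
    rw [cauchyTransform, ← Complex.coe_smul, ← integral_smul]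
    refine integral_congr_ae (Eventually.of_forall fun s => ?_)
    simp only [divSin, smul_smul]
    congr 1
    ring
  simp_rw [e1]
  rw [e2]
  refine tendsto_integral_of_dominated_convergence (fun s => (|y|⁻¹ + M) * ‖u s‖)
    (fun n => ((hcc n).smul hu).aestronglyMeasurable) (hi.norm.const_mul _) (fun n => ?_) ?_
  · refine Eventually.of_forall fun s => ?_
    rw [norm_smul]
    refine mul_le_mul_of_nonneg_right ?_ (norm_nonneg _)
    exact (norm_sub_le _ _).trans (add_le_add (norm_cauchyKernel_le hy _) (hM s _))
  · refine Eventually.of_forall fun s => Tendsto.smul_const ?_ _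
    have h := (tendsto_sum_Sinc_div hθ ht (w := s - y * Complex.I) (by simpa using hy)).const_sub
      (cauchyKernel y (s - t))
    simp only [hc, cauchyKernel_sub_eq] at h ⊢
    convert h using 2
    ring

variable [CompleteSpace X]

/-- The full series leaves the error `E`, the Cauchy transforms of `G / sin`; the factor `(2πi)⁻¹`
cancels the `2π` of the `L²` bound. The number `T` bounds the omitted terms. -/
theorem eLpNorm_sub_sincSum_le {d r θ : ℝ} (hr : 0 < r) (hrd : r < d) (hθ : 0 < θ) {G : ℂ → X}
    (hG : DifferentiableOn ℂ G (strip d))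
    (hi : ∀ y ∈ ({r, -r} : Set ℝ), Integrable fun s : ℝ => G (s + y * Complex.I))
    (hW : ∀ n : ℝ, ∃ R > n, ∫⁻ y in Set.Ioc (-r) r, ‖G (R + y * Complex.I)‖ₑ ≤ 1 ∧
      ∫⁻ y in Set.Ioc (-r) r, ‖G ((-R : ℝ) + y * Complex.I)‖ₑ ≤ 1)
    (K : ℕ) {T : ℝ≥0∞}
    (hT : ∀ n : ℕ, ∑ k ∈ Finset.Icc (-(n : ℤ)) n \ Finset.Icc (-(K : ℤ)) K,
      ENNReal.ofReal √(2 * θ) * ‖G (k * θ : ℝ)‖ₑ ≤ T) :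
    eLpNorm (fun t : ℝ => G t - sincSum θ K (fun x => G x) t) 2 volume ≤
      ENNReal.ofReal (Real.sinh (Real.pi * r / θ))⁻¹ *
        (eLpNorm (fun s : ℝ => G (s + (-r : ℝ) * Complex.I)) 2 volume +
          eLpNorm (fun s : ℝ => G (s + r * Complex.I)) 2 volume) + T := by
  have hr0 := hr.ne'
  have hr0' := neg_ne_zero.2 hr0
  have ip := hi r (by simp)
  have im := hi (-r) (by simp)
  have cp := continuous_comp_line hG (y := r) (by rwa [abs_of_pos hr])
  have cm := continuous_comp_line hG (y := -r) (by rwa [abs_neg, abs_of_pos hr])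
  have cr : Continuous fun x : ℝ => G x := by
    simpa using continuous_comp_line hG (y := 0) (by simpa using hr.trans hrd)
  have hpi : (2 * Real.pi * Complex.I : ℂ) ≠ 0 := by
    simp [Real.pi_ne_zero]
  set um : ℝ → X := fun s => G (s + (-r : ℝ) * Complex.I) with hum
  set up : ℝ → X := fun s => G (s + r * Complex.I) with hup
  set D : ℝ → X := cauchyTransform r (divSin θ r um) - cauchyTransform (-r) (divSin θ (-r) up)
    with hD
  set E : ℝ → X := fun t => (2 * Real.pi * Complex.I : ℂ)⁻¹ • Real.sin (Real.pi * t / θ) • D t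
    with hE
  have mD : MemLp D 2 volume :=
    (memLp_cauchyTransform hr0 (continuous_divSin hθ hr0 cm) (integrable_divSin hθ hr0 cm im)).sub
      (memLp_cauchyTransform hr0' (continuous_divSin hθ hr0' cp) (integrable_divSin hθ hr0' cp ip))
  have mE : AEStronglyMeasurable E volume := by
    have hs : AEStronglyMeasurable (fun t : ℝ => Real.sin (Real.pi * t / θ)) volume :=
      Continuous.aestronglyMeasurable (by fun_prop)
    exact (hs.smul mD.1).const_smul _
  have hformula := cauchy_formula_strip hr hrd hG hi hW
  have hlim : ∀ t : ℝ, (∀ k : ℤ, t ≠ k * θ) →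
      Tendsto (fun n : ℕ => G t - sincSum θ n (fun x => G x) t) atTop (𝓝 (E t)) := fun t ht => by
    have h := ((tendsto_cauchyTransform_sub_sincSum hθ hr0 cm im ht).sub
      (tendsto_cauchyTransform_sub_sincSum hθ hr0' cp ip ht)).const_smul
      (2 * Real.pi * Complex.I : ℂ)⁻¹
    rw [← smul_sub] at h
    refine h.congr fun n => ?_
    rw [inv_smul_eq_iff₀ hpi, smul_sub, hformula t]
    have : (2 * Real.pi * Complex.I : ℂ) • sincSum θ n (fun x => G x) t =
        sincSum θ n (cauchyTransform r um) t - sincSum θ n (cauchyTransform (-r) up) t := by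
      simp only [sincSum]
      rw [Finset.smul_sum, ← Finset.sum_sub_distrib]
      refine Finset.sum_congr rfl fun k _ => ?_
      rw [← smul_sub, ← hformula, smul_comm]
    rw [this]
    abel
  have hEnorm : eLpNorm E 2 volume ≤ ENNReal.ofReal (Real.sinh (Real.pi * r / θ))⁻¹ *
        (eLpNorm um 2 volume + eLpNorm up 2 volume) := by
    have h1 : eLpNorm E 2 volume ≤ ENNReal.ofReal (2 * Real.pi)⁻¹ * eLpNorm D 2 volume := by
      refine eLpNorm_le_mul_eLpNorm_of_ae_le_mul (Eventually.of_forall fun t => ?_) 2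
      simp only [hE]
      rw [norm_smul, norm_smul, norm_inv, norm_mul, norm_mul, Complex.norm_I, mul_one,
        Complex.norm_real, Real.norm_of_nonneg Real.pi_pos.le]
      have : ‖(2 : ℂ)‖ = 2 := by simp
      rw [this]
      refine mul_le_mul_of_nonneg_left ?_ (by positivity)
      exact mul_le_of_le_one_left (norm_nonneg _) (Real.abs_sin_le_one _)
    have h2 : eLpNorm D 2 volume ≤ ENNReal.ofReal (2 * Real.pi) *
        (ENNReal.ofReal (Real.sinh (Real.pi * r / θ))⁻¹ *
        (eLpNorm um 2 volume + eLpNorm up 2 volume)) := by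
      rw [mul_add, mul_add]
      refine (eLpNorm_sub_le (memLp_cauchyTransform hr0 (continuous_divSin hθ hr0 cm)
        (integrable_divSin hθ hr0 cm im)).1 (memLp_cauchyTransform hr0'
        (continuous_divSin hθ hr0' cp) (integrable_divSin hθ hr0' cp ip)).1 one_le_two).trans ?_
      refine add_le_add ?_ ?_
      · refine (eLpNorm_cauchyTransform_le hr0 (continuous_divSin hθ hr0 cm)
          (integrable_divSin hθ hr0 cm im)).trans (mul_le_mul_right ?_ _)
        simpa [abs_of_pos hr] using eLpNorm_divSin_le hθ hr0 um
      · refine (eLpNorm_cauchyTransform_le hr0' (continuous_divSin hθ hr0' cp)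
          (integrable_divSin hθ hr0' cp ip)).trans (mul_le_mul_right ?_ _)
        simpa [abs_of_pos hr] using eLpNorm_divSin_le hθ hr0' up
    refine (h1.trans (mul_le_mul_right h2 _)).trans_eq ?_
    rw [← mul_assoc, ← ENNReal.ofReal_mul (by positivity), inv_mul_cancel₀ (by positivity),
      ENNReal.ofReal_one, one_mul]
  have hae : ∀ᵐ t : ℝ, ∀ k : ℤ, t ≠ k * θ := by
    rw [ae_all_iff]
    exact fun k => compl_mem_ae_iff.2 (measure_singleton _)
  set F : ℝ → X := fun t => G t - sincSum θ K (fun x => G x) t with hF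
  have mF : AEStronglyMeasurable F volume :=
    (cr.sub (continuous_sincSum θ K _)).aestronglyMeasurable
  -- `F - E` is the almost everywhere limit of the partial sums over `K < |k| ≤ n`, so Fatou's lemma
  -- suffices and no `L²` convergence is needed.
  have htail : eLpNorm (F - E) 2 volume ≤ T := by
    set f : ℕ → ℝ → X := fun n t => ∑ k ∈ Finset.Icc (-(n : ℤ)) n \ Finset.Icc (-(K : ℤ)) K,
      Sinc k θ t • G (k * θ : ℝ) with hf
    have mf : ∀ n, AEStronglyMeasurable (f n) volume := fun n =>
      (continuous_finsetSum _ fun k _ =>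
        (continuous_Sinc k θ).smul continuous_const).aestronglyMeasurable
    refine (Lp.eLpNorm_lim_le_liminf_eLpNorm mf (F - E) ?_).trans ?_
    · filter_upwards [hae] with t ht
      refine ((hlim t ht).const_sub (F t)).congr' ?_
      filter_upwards [eventually_ge_atTop K] with n hn
      have hsub : Finset.Icc (-(K : ℤ)) K ⊆ Finset.Icc (-(n : ℤ)) n :=
        Finset.Icc_subset_Icc (by omega) (by omega)
      simp only [hF, hf, sincSum]
      rw [← Finset.sum_sdiff hsub]
      abel
    · refine liminf_le_of_le (by isBoundedDefault) fun b hb => ?_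
      obtain ⟨n, hn⟩ := hb.exists
      refine hn.trans (le_trans ?_ (hT n))
      have e : f n = ∑ k ∈ Finset.Icc (-(n : ℤ)) n \ Finset.Icc (-(K : ℤ)) K,
        fun t => Sinc k θ t • G (k * θ : ℝ) := by
        ext t; simp [hf]
      rw [e]
      refine (eLpNorm_sum_le (fun k _ => ((continuous_Sinc k θ).smul
        continuous_const).aestronglyMeasurable) one_le_two).trans (Finset.sum_le_sum fun k _ => ?_)
      have h1 : eLpNorm (fun t => Sinc k θ t • G (k * θ : ℝ)) 2 volume ≤
          ENNReal.ofReal ‖G (k * θ : ℝ)‖ * eLpNorm (Sinc k θ) 2 volume := by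
        refine eLpNorm_le_mul_eLpNorm_of_ae_le_mul (Eventually.of_forall fun t => ?_) 2
        rw [norm_smul, mul_comm]
      refine h1.trans ?_
      rw [ofReal_norm, mul_comm]
      exact mul_le_mul_left (eLpNorm_Sinc_le hθ k) _
  calc eLpNorm F 2 volume = eLpNorm (E + (F - E)) 2 volume := by rw [add_sub_cancel]
    _ ≤ eLpNorm E 2 volume + eLpNorm (F - E) 2 volume :=
        eLpNorm_add_le mE (mF.sub mE) one_le_two
    _ ≤ _ := add_le_add hEnorm htail

end Discretization

/-! ### Gaussian regularization and passage to the boundary -/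

section Regularization

variable {X : Type*} [NormedAddCommGroup X] [InnerProductSpace ℂ X]

/-- Multiplication by the Gaussian `exp (-ε w²)`. -/
noncomputable def gaussReg (ε : ℝ) (G : ℂ → X) (w : ℂ) : X := Complex.exp (-ε * w ^ 2) • G w

theorem norm_exp_neg_mul_sq (ε s y : ℝ) :
    ‖Complex.exp (-ε * ((s : ℂ) + y * Complex.I) ^ 2)‖ =
      Real.exp (ε * y ^ 2) * Real.exp (-ε * s ^ 2) := by
  rw [Complex.norm_exp, ← Real.exp_add]
  congr 1
  have : -(ε : ℂ) * ((s : ℂ) + y * Complex.I) ^ 2 =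
      (ε * y ^ 2 + -ε * s ^ 2 : ℝ) + (-(2 * ε * s * y) : ℝ) * Complex.I := by
    push_cast; linear_combination (-(ε : ℂ) * y ^ 2) * Complex.I_sq
  rw [this, Complex.add_re, Complex.ofReal_re, Complex.re_ofReal_mul]
  simp

theorem norm_gaussReg_le {ε : ℝ} (hε : 0 < ε) (G : ℂ → X) (s y : ℝ) :
    ‖gaussReg ε G (s + y * Complex.I)‖ ≤ Real.exp (ε * y ^ 2) * ‖G (s + y * Complex.I)‖ := by
  rw [gaussReg, norm_smul, norm_exp_neg_mul_sq]
  refine mul_le_mul_of_nonneg_right ?_ (norm_nonneg _)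
  refine mul_le_of_le_one_right (Real.exp_pos _).le (Real.exp_le_one_iff.2 ?_)
  nlinarith [sq_nonneg s]

theorem eLpNorm_gaussReg_le {ε : ℝ} (hε : 0 < ε) (G : ℂ → X) (y : ℝ) :
    eLpNorm (fun s : ℝ => gaussReg ε G (s + y * Complex.I)) 2 volume ≤
      ENNReal.ofReal (Real.exp (ε * y ^ 2)) *
        eLpNorm (fun s : ℝ => G (s + y * Complex.I)) 2 volume :=
  eLpNorm_le_mul_eLpNorm_of_ae_le_mul (Eventually.of_forall fun s => norm_gaussReg_le hε G s y) 2

theorem memLp_exp_neg_mul_sq {ε : ℝ} (hε : 0 < ε) :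
    MemLp (fun s : ℝ => Real.exp (-ε * s ^ 2)) 2 volume := by
  rw [memLp_two_iff_integrable_sq_norm (Continuous.aestronglyMeasurable (by fun_prop))]
  refine (integrable_exp_neg_mul_sq (b := 2 * ε) (by positivity)).congr
    (Eventually.of_forall fun s => ?_)
  simp only
  rw [Real.norm_of_nonneg (Real.exp_pos _).le, ← Real.exp_nat_mul]
  congr 1
  push_cast; ring

/-- Cauchy–Schwarz against the Gaussian turns `L²` control on a line into `L¹` control. -/
theorem eLpNorm_one_gaussReg_le (ε : ℝ) {d y : ℝ} {G : ℂ → X}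
    (hG : DifferentiableOn ℂ G (strip d)) (hy : |y| < d) :
    eLpNorm (fun s : ℝ => gaussReg ε G (s + y * Complex.I)) 1 volume ≤
      ENNReal.ofReal (Real.exp (ε * y ^ 2)) * (eLpNorm (fun s : ℝ => Real.exp (-ε * s ^ 2)) 2 volume *
        eLpNorm (fun s : ℝ => G (s + y * Complex.I)) 2 volume) := by
  have h1 : eLpNorm (fun s : ℝ => gaussReg ε G (s + y * Complex.I)) 1 volume ≤
      ENNReal.ofReal (Real.exp (ε * y ^ 2)) *
        eLpNorm (fun s : ℝ => Real.exp (-ε * s ^ 2) • G (s + y * Complex.I)) 1 volume := by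
    refine eLpNorm_le_mul_eLpNorm_of_ae_le_mul (Eventually.of_forall fun s => le_of_eq ?_) 1
    rw [gaussReg, norm_smul, norm_exp_neg_mul_sq, norm_smul, Real.norm_of_nonneg (Real.exp_pos _).le]
    ring
  refine h1.trans (mul_le_mul_right ?_ _)
  exact eLpNorm_smul_le_mul_eLpNorm (continuous_comp_line hG hy).aestronglyMeasurable
    (Continuous.aestronglyMeasurable (by fun_prop))

theorem differentiableOn_gaussReg (ε : ℝ) {d : ℝ} {G : ℂ → X}
    (hG : DifferentiableOn ℂ G (strip d)) : DifferentiableOn ℂ (gaussReg ε G) (strip d) := by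
  unfold gaussReg
  refine DifferentiableOn.smul ?_ hG
  exact Differentiable.differentiableOn (by fun_prop)

/-- By Tonelli, uniform `L¹` bounds on horizontal lines make the integrals over vertical segments
integrable in the abscissa. The line `y = 0`, not covered by the hypothesis, is negligible. -/
theorem exists_gt_vertical_le_one {d r : ℝ} (hrd : r < d) {G : ℂ → X}
    (hG : DifferentiableOn ℂ G (strip d)) {B : ℝ≥0∞} (hB : B ≠ ∞)
    (h : ∀ y : ℝ, y ≠ 0 → |y| ≤ r → ∫⁻ s : ℝ, ‖G (s + y * Complex.I)‖ₑ ≤ B) (n : ℝ) :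
    ∃ R > n, ∫⁻ y in Set.Ioc (-r) r, ‖G (R + y * Complex.I)‖ₑ ≤ 1 ∧
      ∫⁻ y in Set.Ioc (-r) r, ‖G ((-R : ℝ) + y * Complex.I)‖ₑ ≤ 1 := by
  have hm : AEMeasurable (Function.uncurry fun x y : ℝ => ‖G (x + y * Complex.I)‖ₑ)
      (volume.prod (volume.restrict (Set.Ioc (-r) r))) := by
    have e : (volume : Measure ℝ).prod (volume.restrict (Set.Ioc (-r) r)) =
        ((volume : Measure ℝ).prod volume).restrict (Set.univ ×ˢ Set.Ioc (-r) r) := by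
      rw [← Measure.prod_restrict, Measure.restrict_univ]
    rw [e]
    refine ContinuousOn.aemeasurable ?_ (MeasurableSet.univ.prod measurableSet_Ioc)
    refine ContinuousOn.enorm (hG.continuousOn.comp (by fun_prop) fun p hp => ?_)
    exact add_mul_I_mem_strip ((abs_le.2 ⟨hp.2.1.le, hp.2.2⟩).trans_lt hrd) _
  refine exists_gt_le_one_of_lintegral_ne_top
    (W := fun x => ∫⁻ y in Set.Ioc (-r) r, ‖G (x + y * Complex.I)‖ₑ) ?_ ?_ n
  · exact hm.lintegral_prod_right'
  · rw [lintegral_lintegral_swap hm]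
    have hae : ∀ᵐ y : ℝ ∂volume.restrict (Set.Ioc (-r) r),
        ∫⁻ s : ℝ, ‖G (s + y * Complex.I)‖ₑ ≤ B := by
      have h0 : ∀ᵐ y : ℝ ∂volume.restrict (Set.Ioc (-r) r), y ≠ 0 :=
        ae_restrict_of_ae (compl_mem_ae_iff.2 (measure_singleton _))
      filter_upwards [h0, ae_restrict_mem measurableSet_Ioc] with y hy0 hy
      exact h y hy0 (abs_le.2 ⟨hy.1.le, hy.2⟩)
    refine ((lintegral_mono_ae hae).trans_lt ?_).ne
    rw [lintegral_const, Measure.restrict_apply_univ, Real.volume_Ioc]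
    exact ENNReal.mul_lt_top hB.lt_top ENNReal.ofReal_lt_top

variable [CompleteSpace X]

theorem eLpNorm_sub_sincSum_le_of_hardy {d θ : ℝ} (hd : 0 < d) (hθ : 0 < θ) {G : ℂ → X}
    (hG : DifferentiableOn ℂ G (strip d)) {N : ℝ≥0∞} (hN : N ≠ ∞)
    (hGN : ∀ y : ℝ, y ≠ 0 → |y| < d → eLpNorm (fun s : ℝ => G (s + y * Complex.I)) 2 volume ≤ N)
    (K : ℕ) {T : ℝ≥0∞}
    (hT : ∀ n : ℕ, ∑ k ∈ Finset.Icc (-(n : ℤ)) n \ Finset.Icc (-(K : ℤ)) K,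
      ENNReal.ofReal √(2 * θ) * ‖G (k * θ : ℝ)‖ₑ ≤ T) :
    eLpNorm (fun t : ℝ => G t - sincSum θ K (fun x => G x) t) 2 volume ≤
      ENNReal.ofReal (Real.sinh (Real.pi * d / θ))⁻¹ * (2 * N) + T := by
  have key : ∀ ε r : ℝ, 0 < ε → 0 < r → r < d →
      eLpNorm (fun t : ℝ => gaussReg ε G t - sincSum θ K (fun x => gaussReg ε G x) t) 2 volume ≤
      ENNReal.ofReal (Real.sinh (Real.pi * r / θ))⁻¹ *
        (ENNReal.ofReal (Real.exp (ε * d ^ 2)) * (2 * N)) + T := fun ε r hε hr hrd => by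
    have hexp : ∀ y : ℝ, |y| < d →
        ENNReal.ofReal (Real.exp (ε * y ^ 2)) ≤ ENNReal.ofReal (Real.exp (ε * d ^ 2)) := fun y hy => by
      refine ENNReal.ofReal_le_ofReal (Real.exp_le_exp.2 (mul_le_mul_of_nonneg_left ?_ hε.le))
      rw [← sq_abs]
      exact pow_le_pow_left₀ (abs_nonneg _) hy.le 2
    have hL1 : ∀ y : ℝ, y ≠ 0 → |y| < d →
        eLpNorm (fun s : ℝ => gaussReg ε G (s + y * Complex.I)) 1 volume ≤
        ENNReal.ofReal (Real.exp (ε * d ^ 2)) *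
          (eLpNorm (fun s : ℝ => Real.exp (-ε * s ^ 2)) 2 volume * N) := fun y hy0 hy =>
      (eLpNorm_one_gaussReg_le ε hG hy).trans
        (mul_le_mul' (hexp y hy) (mul_le_mul_right (hGN y hy0 hy) _))
    have hB : ENNReal.ofReal (Real.exp (ε * d ^ 2)) *
          (eLpNorm (fun s : ℝ => Real.exp (-ε * s ^ 2)) 2 volume * N) ≠ ∞ :=
      ENNReal.mul_ne_top ENNReal.ofReal_ne_top
        (ENNReal.mul_ne_top (memLp_exp_neg_mul_sq hε).2.ne hN)
    have hGd := differentiableOn_gaussReg ε hG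
    have hL2 : ∀ y : ℝ, y ≠ 0 → |y| < d →
        eLpNorm (fun s : ℝ => gaussReg ε G (s + y * Complex.I)) 2 volume ≤
        ENNReal.ofReal (Real.exp (ε * d ^ 2)) * N := fun y hy0 hy =>
      (eLpNorm_gaussReg_le hε G y).trans (mul_le_mul' (hexp y hy) (hGN y hy0 hy))
    have hr1 : |r| < d := by rwa [abs_of_pos hr]
    have hr2 : |-r| < d := by rwa [abs_neg]
    -- On the real line the Gaussian is at most `1`, so the same `T` works for every `ε`.
    have hT' : ∀ n : ℕ, ∑ k ∈ Finset.Icc (-(n : ℤ)) n \ Finset.Icc (-(K : ℤ)) K,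
        ENNReal.ofReal √(2 * θ) * ‖gaussReg ε G (k * θ : ℝ)‖ₑ ≤ T := fun n => by
      refine (Finset.sum_le_sum fun k _ => mul_le_mul_right ?_ _).trans (hT n)
      have := norm_gaussReg_le hε G (k * θ) 0
      simp only [Complex.ofReal_zero, zero_mul, add_zero, ne_eq, OfNat.ofNat_ne_zero,
        not_false_eq_true, zero_pow, mul_zero, Real.exp_zero, one_mul] at this
      rw [← ofReal_norm, ← ofReal_norm]
      exact ENNReal.ofReal_le_ofReal this
    refine (eLpNorm_sub_sincSum_le hr hrd hθ hGd ?_ ?_ K hT').trans ?_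
    · intro y hy
      have hy' : y ≠ 0 ∧ |y| < d := by
        rcases hy with rfl | rfl
        · exact ⟨hr.ne', hr1⟩
        · exact ⟨neg_ne_zero.2 hr.ne', hr2⟩
      rw [← memLp_one_iff_integrable]
      exact ⟨(continuous_comp_line hGd hy'.2).aestronglyMeasurable,
        (hL1 y hy'.1 hy'.2).trans_lt hB.lt_top⟩
    · refine exists_gt_vertical_le_one hrd hGd hB fun y hy0 hy => ?_
      rw [← eLpNorm_one_eq_lintegral_enorm]
      exact hL1 y hy0 (hy.trans_lt hrd)
    · refine add_le_add_left (mul_le_mul_right ?_ _) _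
      rw [two_mul, mul_add]
      exact add_le_add (hL2 _ (neg_ne_zero.2 hr.ne') hr2) (hL2 _ hr.ne' hr1)
  set ε : ℕ → ℝ := fun n => 1 / ((n : ℝ) + 1) with hε
  have hεpos : ∀ n, 0 < ε n := fun n => by simp only [hε]; positivity
  have hεlim : Tendsto ε atTop (𝓝 0) := tendsto_one_div_add_atTop_nhds_zero_nat
  -- The half keeps `r 0` positive, because `ε 0 = 1`.
  set r : ℕ → ℝ := fun n => d * (1 - ε n / 2) with hr
  have hε1 : ∀ n, ε n ≤ 1 := fun n => by
    simp only [hε]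
    rw [div_le_one (by positivity)]
    have : (0 : ℝ) ≤ n := n.cast_nonneg
    linarith
  have hrpos : ∀ n, 0 < r n := fun n => mul_pos hd (by have := hε1 n; linarith)
  have hrd : ∀ n, r n < d := fun n => mul_lt_of_lt_one_right hd (by have := hεpos n; linarith)
  have hrlim : Tendsto r atTop (𝓝 d) := by
    have := ((hεlim.div_const 2).const_sub 1).const_mul d
    simpa using this
  have cr : ∀ n, Continuous fun x : ℝ => gaussReg (ε n) G x := fun n => by
    simpa using continuous_comp_line (differentiableOn_gaussReg (ε n) hG) (y := 0) (by simpa using hd)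
  have hpt : ∀ x : ℝ, Tendsto (fun n => gaussReg (ε n) G x) atTop (𝓝 (G x)) := fun x => by
    have h1 : Tendsto (fun n => Complex.exp (-(ε n : ℂ) * (x : ℂ) ^ 2)) atTop (𝓝 1) := by
      have hc : Continuous fun e : ℝ => Complex.exp (-(e : ℂ) * (x : ℂ) ^ 2) := by fun_prop
      simpa [Function.comp_def] using (hc.tendsto 0).comp hεlim
    simpa [gaussReg] using h1.smul_const (G x)
  have h1 := Lp.eLpNorm_lim_le_liminf_eLpNorm (p := 2) (μ := volume)
    (f := fun n (t : ℝ) => gaussReg (ε n) G t - sincSum θ K (fun x => gaussReg (ε n) G x) t)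
    (fun n => ((cr n).sub (continuous_sincSum θ K _)).aestronglyMeasurable)
    (fun t : ℝ => G t - sincSum θ K (fun x => G x) t) (Eventually.of_forall fun t =>
      (hpt t).sub (tendsto_finsetSum _ fun k _ => (hpt _).const_smul _))
  refine h1.trans ((liminf_le_liminf (Eventually.of_forall fun n =>
    key (ε n) (r n) (hεpos n) (hrpos n) (hrd n))).trans (le_of_eq (Tendsto.liminf_eq ?_)))
  refine Tendsto.add ?_ tendsto_const_nhds
  have t1 : Tendsto (fun n => ENNReal.ofReal (Real.sinh (Real.pi * r n / θ))⁻¹) atTop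
      (𝓝 (ENNReal.ofReal (Real.sinh (Real.pi * d / θ))⁻¹)) := by
    refine ENNReal.tendsto_ofReal (Tendsto.inv₀ ?_ (Real.sinh_pos_iff.2
      (by have := Real.pi_pos; positivity)).ne')
    exact (Real.continuous_sinh.tendsto _).comp ((hrlim.const_mul _).div_const _)
  have t2 : Tendsto (fun n => ENNReal.ofReal (Real.exp (ε n * d ^ 2))) atTop (𝓝 1) := by
    have hc : Continuous fun e : ℝ => ENNReal.ofReal (Real.exp (e * d ^ 2)) :=
      ENNReal.continuous_ofReal.comp (by fun_prop)
    simpa [Function.comp_def] using (hc.tendsto 0).comp hεlim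
  have hN2 : 2 * N ≠ ∞ := ENNReal.mul_ne_top (by simp) hN
  have t3 := ENNReal.Tendsto.mul_const (b := 2 * N) t2 (Or.inr hN2)
  rw [one_mul] at t3
  exact ENNReal.Tendsto.mul t1 (Or.inr hN2) t3 (Or.inr ENNReal.ofReal_ne_top)

end Regularization

/-! ### The conformal map `sinh` from the strip -/

section StripMap

theorem cosh_re_pos {d : ℝ} (hd : d < Real.pi / 2) {w : ℂ} (hw : w ∈ strip d) :
    0 < (Complex.cosh w).re := by
  have h : (Complex.cosh w).re = Real.cosh w.re * Real.cos w.im := by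
    conv_lhs => rw [← Complex.re_add_im w, Complex.cosh_add, Complex.cosh_mul_I,
      Complex.sinh_mul_I, ← Complex.ofReal_cosh, ← Complex.ofReal_sinh, ← Complex.ofReal_cos,
      ← Complex.ofReal_sin]
    simp [-Complex.ofReal_cos, -Complex.ofReal_sin, -Complex.ofReal_cosh, -Complex.ofReal_sinh]
  rw [h]
  have h2 := abs_lt.1 (show |w.im| < d from hw)
  exact mul_pos (Real.cosh_pos _) (Real.cos_pos_of_mem_Ioo ⟨by linarith, by linarith⟩)

/-- On the strip `cosh` has positive real part, so the principal root of `1 + sinh² w` is `cosh w`,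
and `sinh w + cosh w = e^w` has argument `Im w`. -/
theorem sinh_mem_domain {d : ℝ} (hd : d < Real.pi / 2) {w : ℂ} (hw : w ∈ strip d) :
    Complex.sinh w ∈ domain d := by
  have h0 := cosh_re_pos hd hw
  have h1 : (1 + Complex.sinh w ^ 2) ^ (1 / 2 : ℂ) = Complex.cosh w := by
    rw [add_comm, ← Complex.cosh_sq, one_div,
      Complex.sq_cpow_two_inv h0]
  have h2 := abs_lt.1 (show |w.im| < d from hw)
  have hpi := Real.pi_pos
  change |Complex.arg _| < d
  rw [h1, Complex.sinh_add_cosh, ← Complex.log_im,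
    Complex.log_exp (by linarith) (by linarith)]
  exact hw

theorem ofReal_mem_domain {d : ℝ} (hd0 : 0 < d) (hd : d < Real.pi / 2) (x : ℝ) :
    (x : ℂ) ∈ domain d := by
  have := sinh_mem_domain hd (ofReal_mem_strip hd0 (Real.arsinh x))
  rwa [← Complex.ofReal_sinh, Real.sinh_arsinh] at this

variable {X : Type*} [NormedAddCommGroup X] [InnerProductSpace ℂ X]

/-- The function `w ↦ cosh(w)^{1/2} F(sinh w)` on the strip. -/
noncomputable def pullback (F : ℂ → X) (w : ℂ) : X :=
  Complex.cosh w ^ (2⁻¹ : ℂ) • F (Complex.sinh w)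

theorem differentiableOn_pullback {d : ℝ} (hd : d < Real.pi / 2) {F : ℂ → X}
    (hF : AnalyticOnNhd ℂ F (domain d)) : DifferentiableOn ℂ (pullback F) (strip d) := by
  refine DifferentiableOn.smul ?_ ?_
  · refine DifferentiableOn.cpow_const (Complex.differentiable_cosh.differentiableOn) fun w hw => ?_
    exact Or.inl (cosh_re_pos hd hw)
  · exact hF.differentiableOn.comp Complex.differentiable_sinh.differentiableOn
      fun w hw => sinh_mem_domain hd hw

theorem norm_pullback_sq (F : ℂ → X) (w : ℂ) :
    ‖pullback F w‖ ^ 2 = ‖F (Complex.sinh w)‖ ^ 2 * ‖Complex.cosh w‖ := by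
  rw [pullback, norm_smul, mul_pow, ← norm_pow, Complex.cpow_ofNat_inv_pow, mul_comm]

theorem deriv_curve (y s : ℝ) : deriv (curve y) s = Complex.cosh (s + y * Complex.I) := by
  have h : HasDerivAt (fun t : ℝ => (t : ℂ) + y * Complex.I) 1 s :=
    (Complex.ofRealCLM.hasDerivAt (x := s)).add_const _
  refine Eq.trans ?_ (((Complex.hasDerivAt_sinh _).comp_of_eq s h rfl).deriv.trans (mul_one _))
  rfl

theorem lintegral_pullback_line (F : ℂ → X) (y : ℝ) :
    ∫⁻ s : ℝ, ‖pullback F (s + y * Complex.I)‖ₑ ^ 2 =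
      arcLengthIntegral (curve y) fun z => ‖F z‖ₑ ^ (2 : ℝ) := by
  refine lintegral_congr fun s => ?_
  simp only [deriv_curve, ENNReal.rpow_two, curve]
  rw [← ofReal_norm, ← ofReal_norm, ← ofReal_norm, ← ENNReal.ofReal_pow (norm_nonneg _),
    ← ENNReal.ofReal_pow (norm_nonneg _), ← ENNReal.ofReal_mul (by positivity), norm_pullback_sq]

/-- The line at height `y` is one of the two curves bounding `domain |y|`. The height `0` is
excluded since the supremum runs over `r > 0`. -/
theorem eLpNorm_pullback_line_le (F : ℂ → X) {d y : ℝ} (hy0 : y ≠ 0) (hy : |y| < d) :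
    eLpNorm (fun s : ℝ => pullback F (s + y * Complex.I)) 2 volume ≤ hardyNorm 2 d F := by
  apply eLpNorm_two_le
  rw [lintegral_pullback_line, hardyNorm, ← ENNReal.rpow_two, ← ENNReal.rpow_mul,
    one_div_mul_cancel two_ne_zero, ENNReal.rpow_one]
  refine le_trans ?_ (le_iSup₂ (f := fun r (_ : r ∈ Set.Ioo (0 : ℝ) d) => boundaryIntegral 2 r F)
    |y| ⟨abs_pos.2 hy0, hy⟩)
  rw [boundaryIntegral]
  rcases abs_choice y with h | h
  · rw [h]; exact le_self_add
  · rw [h, neg_neg]; exact le_add_self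

end StripMap

/-! ### Transfer of the error to the real line -/

section RealLine

variable {X : Type*} [NormedAddCommGroup X] [InnerProductSpace ℂ X]

theorem pullback_ofReal (F : ℂ → X) (t : ℝ) :
    pullback F t = √(Real.cosh t) • F (Real.sinh t : ℝ) := by
  rw [pullback, ← Complex.ofReal_cosh, ← Complex.ofReal_sinh, ← Complex.coe_smul,
    Real.sqrt_eq_rpow, Complex.ofReal_cpow (Real.cosh_pos _).le]
  norm_num

theorem exp_abs_le_two_mul_cosh (t : ℝ) : Real.exp |t| ≤ 2 * Real.cosh t := by
  rw [← Real.cosh_abs, Real.cosh_eq]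
  have := Real.exp_pos (-|t|)
  linarith

/-- At `x = sinh t` the decay hypothesis reads `C / cosh t`; the weight `cosh^{1/2}` leaves `C /
cosh^{1/2} t`, and `2 cosh t ≥ e^{|t|}`. -/
theorem norm_pullback_ofReal_le {F : ℂ → X} {C : ℝ} (hC : 0 < C)
    (hF : ∀ x : ℝ, ‖F x‖ ≤ C / √(1 + x ^ 2)) (t : ℝ) :
    ‖pullback F t‖ ≤ √2 * C * Real.exp (-|t| / 2) := by
  have hc := Real.cosh_pos t
  have h := hF (Real.sinh t)
  rw [add_comm, ← Real.cosh_sq, Real.sqrt_sq hc.le] at h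
  refine (pow_le_pow_iff_left₀ (norm_nonneg _) (by positivity) two_ne_zero).1 ?_
  rw [norm_pullback_sq, ← Complex.ofReal_sinh, ← Complex.ofReal_cosh, Complex.norm_real,
    Real.norm_of_nonneg hc.le]
  have h2 : ‖F (Real.sinh t : ℝ)‖ ^ 2 ≤ (C / Real.cosh t) ^ 2 :=
    pow_le_pow_left₀ (norm_nonneg _) h 2
  have h3 : (√2 * C * Real.exp (-|t| / 2)) ^ 2 = 2 * C ^ 2 * (Real.exp |t|)⁻¹ := by
    rw [mul_pow, mul_pow, Real.sq_sqrt zero_le_two, ← Real.exp_nat_mul, ← Real.exp_neg]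
    congr 2; push_cast; ring
  rw [h3]
  calc _ ≤ (C / Real.cosh t) ^ 2 * Real.cosh t := mul_le_mul_of_nonneg_right h2 hc.le
    _ = 2 * C ^ 2 * (2 * Real.cosh t)⁻¹ := by field_simp
    _ ≤ _ := mul_le_mul_of_nonneg_left (inv_anti₀ (Real.exp_pos _) (exp_abs_le_two_mul_cosh t))
        (by positivity)

theorem deriv_phi : deriv phi = fun x => (√(1 + x ^ 2))⁻¹ :=
  funext fun x => (Real.hasDerivAt_arsinh x).deriv

theorem sqrt_deriv_phi_sinh (t : ℝ) : √(deriv phi (Real.sinh t)) = (√(Real.cosh t))⁻¹ := by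
  simp only [deriv_phi]
  rw [add_comm, ← Real.cosh_sq, Real.sqrt_sq (Real.cosh_pos t).le, Real.sqrt_inv]

theorem sub_interpolant_sinh (θ : ℝ) (K : ℕ) (F : ℂ → X) (t : ℝ) :
    F (Real.sinh t : ℝ) - interpolant θ K F (Real.sinh t) =
      (√(Real.cosh t))⁻¹ • (pullback F t - sincSum θ K (fun x => pullback F x) t) := by
  have hc : √(Real.cosh t) ≠ 0 := (Real.sqrt_pos.2 (Real.cosh_pos t)).ne'
  rw [smul_sub, pullback_ofReal, inv_smul_smul₀ hc, interpolant, sqrt_deriv_phi_sinh, sincSum]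
  congr 2
  refine Finset.sum_congr rfl fun k _ => ?_
  rw [pullback_ofReal, sincPoint, sqrt_deriv_phi_sinh, phi, Real.arsinh_sinh, smul_smul,
    div_inv_eq_mul]

theorem eLpNorm_sub_interpolant (θ : ℝ) (K : ℕ) (F : ℂ → X) :
    eLpNorm (fun x : ℝ => F x - interpolant θ K F x) 2 volume =
      eLpNorm (fun t : ℝ => pullback F t - sincSum θ K (fun x => pullback F x) t) 2 volume := by
  refine (ENNReal.pow_right_strictMono two_ne_zero).injective ?_
  simp only [eLpNorm_two_sq]
  have h := lintegral_image_eq_lintegral_abs_deriv_mul MeasurableSet.univ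
    (fun x _ => (Real.hasDerivAt_sinh x).hasDerivWithinAt) Real.sinh_injective.injOn
    (fun x : ℝ => ‖F x - interpolant θ K F x‖ₑ ^ 2)
  rw [Set.image_univ, Real.sinh_surjective.range_eq, setLIntegral_univ, setLIntegral_univ] at h
  rw [h]
  refine lintegral_congr fun t => ?_
  have hc := Real.cosh_pos t
  rw [sub_interpolant_sinh, enorm_smul, mul_pow, ← mul_assoc, Real.enorm_eq_ofReal (by positivity),
    ← ENNReal.ofReal_pow (by positivity), abs_of_pos hc, ← ENNReal.ofReal_mul hc.le, inv_pow,
    Real.sq_sqrt hc.le, mul_inv_cancel₀ hc.ne', ENNReal.ofReal_one, one_mul]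

theorem continuous_interpolant (θ : ℝ) (K : ℕ) (F : ℂ → X) : Continuous (interpolant θ K F) := by
  have h1 : Continuous fun x => √(deriv phi x) := by
    rw [deriv_phi]
    refine Real.continuous_sqrt.comp (Continuous.inv₀ (f := fun x : ℝ => √(1 + x ^ 2))
      (by fun_prop) fun x => ?_)
    positivity
  have h2 : ∀ k : ℤ, Continuous fun x => Sinc k θ (phi x) / √(deriv phi (sincPoint θ k)) :=
    fun k => ((continuous_Sinc k θ).comp Real.continuous_arsinh).div_const _
  exact h1.smul (continuous_finsetSum _ fun k _ => (h2 k).smul continuous_const)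

end RealLine

/-! ### Truncation error -/

section Tail

theorem sum_sdiff_pow_natAbs_le {q : ℝ} (hq0 : 0 ≤ q) (hq1 : q < 1) (n K : ℕ) :
    ∑ k ∈ Finset.Icc (-(n : ℤ)) n \ Finset.Icc (-(K : ℤ)) K, q ^ k.natAbs ≤
      2 * (q ^ (K + 1) / (1 - q)) := by
  have hq : 0 < 1 - q := sub_pos.2 hq1
  rcases le_total n K with h | h
  · rw [Finset.sdiff_eq_empty_iff_subset.2 (Finset.Icc_subset_Icc (by omega) (by omega)),
      Finset.sum_empty]
    positivity
  · have hsub : Finset.Icc (-(K : ℤ)) K ⊆ Finset.Icc (-(n : ℤ)) n :=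
      Finset.Icc_subset_Icc (by omega) (by omega)
    have h1 := Finset.sum_sdiff (f := fun k : ℤ => q ^ k.natAbs) hsub
    rw [sum_Icc_neg_eq_add_sum_range, sum_Icc_neg_eq_add_sum_range] at h1
    have h2 : ∀ m : ℕ, q ^ ((m : ℤ) + 1).natAbs + q ^ (-((m : ℤ) + 1)).natAbs =
        2 * q ^ (m + 1) := fun m => by
      rw [Int.natAbs_neg, show ((m : ℤ) + 1).natAbs = m + 1 by omega]; ring
    simp only [h2] at h1
    have h3 : ∑ k ∈ Finset.Icc (-(n : ℤ)) n \ Finset.Icc (-(K : ℤ)) K, q ^ k.natAbs =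
        ∑ m ∈ Finset.Ico K n, 2 * q ^ (m + 1) := by
      rw [Finset.sum_Ico_eq_sub _ h]; linarith
    rw [h3, ← Finset.mul_sum]
    refine mul_le_mul_of_nonneg_left ?_ zero_le_two
    simp only [pow_succ]
    rw [← Finset.sum_mul, mul_div_right_comm]
    exact mul_le_mul_of_nonneg_right (geom_sum_Ico_le_of_lt_one hq0 hq1) hq0

variable {X : Type*} [NormedAddCommGroup X] [InnerProductSpace ℂ X]

theorem sum_sdiff_norm_pullback_le {F : ℂ → X} {C θ : ℝ} (hC : 0 < C) (hθ : 0 < θ)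
    (hF : ∀ x : ℝ, ‖F x‖ ≤ C / √(1 + x ^ 2)) (n K : ℕ) :
    ∑ k ∈ Finset.Icc (-(n : ℤ)) n \ Finset.Icc (-(K : ℤ)) K,
      ENNReal.ofReal √(2 * θ) * ‖pullback F (k * θ : ℝ)‖ₑ ≤
      ENNReal.ofReal (8 * C * Real.exp (-(K * θ / 2)) / √θ) := by
  set q := Real.exp (-(θ / 2)) with hq
  have hq0 : 0 < q := Real.exp_pos _
  have hq1 : q < 1 := Real.exp_lt_one_iff.2 (by linarith)
  have h1 : ∀ k : ℤ, ENNReal.ofReal √(2 * θ) * ‖pullback F (k * θ : ℝ)‖ₑ ≤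
      ENNReal.ofReal (√(2 * θ) * (√2 * C * q ^ k.natAbs)) := fun k => by
    rw [← ofReal_norm, ← ENNReal.ofReal_mul (Real.sqrt_nonneg _)]
    refine ENNReal.ofReal_le_ofReal (mul_le_mul_of_nonneg_left ?_ (Real.sqrt_nonneg _))
    refine (norm_pullback_ofReal_le hC hF _).trans_eq ?_
    congr 1
    rw [hq, ← Real.exp_nat_mul, abs_mul, abs_of_pos hθ, Nat.cast_natAbs, Int.cast_abs]
    congr 1; ring
  refine (Finset.sum_le_sum fun k _ => h1 k).trans ?_
  rw [← ENNReal.ofReal_sum_of_nonneg (fun k _ => by positivity)]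
  refine ENNReal.ofReal_le_ofReal ?_
  rw [← Finset.mul_sum, ← Finset.mul_sum]
  -- Since `q = e^{-θ/2}`, the quotient `q/(1 - q)` equals `1/(e^{θ/2} - 1)`, which is at most
  -- `2/θ`.
  have h2 : q ^ (K + 1) / (1 - q) ≤ Real.exp (-(K * θ / 2)) * (2 / θ) := by
    have e1 : q ^ K = Real.exp (-(K * θ / 2)) := by
      rw [hq, ← Real.exp_nat_mul]; congr 1; ring
    have e2 : q * Real.exp (θ / 2) = 1 := by rw [hq, ← Real.exp_add]; simp
    have e3 := Real.add_one_le_exp (θ / 2)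
    rw [pow_succ, e1, mul_div_assoc]
    refine mul_le_mul_of_nonneg_left ?_ (Real.exp_pos _).le
    rw [div_le_div_iff₀ (sub_pos.2 hq1) hθ]
    nlinarith
  have hs : √(2 * θ) * √2 = 2 * √θ := by
    rw [Real.sqrt_mul zero_le_two, mul_right_comm, Real.mul_self_sqrt zero_le_two]
  have hθs : √θ * √θ = θ := Real.mul_self_sqrt hθ.le
  have hsp : 0 < √θ := Real.sqrt_pos.2 hθ
  calc _ ≤ √(2 * θ) * (√2 * C * (2 * (Real.exp (-(K * θ / 2)) * (2 / θ)))) := by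
        refine mul_le_mul_of_nonneg_left (mul_le_mul_of_nonneg_left ?_ (by positivity))
          (Real.sqrt_nonneg _)
        exact (sum_sdiff_pow_natAbs_le hq0.le hq1 n K).trans
          (mul_le_mul_of_nonneg_left h2 zero_le_two)
    _ = (√(2 * θ) * √2) * (C * (4 * Real.exp (-(K * θ / 2)) / (√θ * √θ))) := by rw [hθs]; ring
    _ = _ := by rw [hs]; field_simp; ring

end Tail

/-! ### Balancing the two errors -/

section Constants

/-- The constant of the error bound. -/
noncomputable def errorConst (d : ℝ) : ℝ :=
  4 / (1 - Real.exp (-(2 * √(Real.pi * d / 2)))) + 8 / √√(2 * Real.pi * d)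

theorem one_sub_exp_pos {d : ℝ} (hd : 0 < d) :
    0 < 1 - Real.exp (-(2 * √(Real.pi * d / 2))) := by
  have := Real.pi_pos
  rw [sub_pos, Real.exp_lt_one_iff]
  have : 0 < √(Real.pi * d / 2) := Real.sqrt_pos.2 (by positivity)
  linarith

theorem errorConst_pos {d : ℝ} (hd : 0 < d) : 0 < errorConst d := by
  have := one_sub_exp_pos hd
  have := Real.pi_pos
  unfold errorConst
  positivity

/-- The second summand alone, of order `d^{-1/4}`, already diverges. -/
theorem tendsto_errorConst : Tendsto errorConst (𝓝[>] 0) atTop := by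
  have hc : Continuous fun d : ℝ => √√(2 * Real.pi * d) := by fun_prop
  have h1 : Tendsto (fun d : ℝ => √√(2 * Real.pi * d)) (𝓝[>] 0) (𝓝[>] 0) := by
    refine tendsto_nhdsWithin_iff.2 ⟨?_, ?_⟩
    · simpa using (hc.tendsto 0).mono_left nhdsWithin_le_nhds
    · filter_upwards [self_mem_nhdsWithin] with d (hd : 0 < d)
      have := Real.pi_pos
      exact Real.sqrt_pos.2 (Real.sqrt_pos.2 (by positivity))
  have h2 := (tendsto_inv_nhdsGT_zero.comp h1).const_mul_atTop (by norm_num : (0 : ℝ) < 8)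
  refine tendsto_atTop_mono' _ ?_ h2
  filter_upwards [self_mem_nhdsWithin] with d (hd : 0 < d)
  have := one_sub_exp_pos hd
  simp only [errorConst, Function.comp_apply, ← div_eq_mul_inv]
  exact le_add_of_nonneg_left (by positivity)

theorem inv_sinh_le {s₀ s : ℝ} (h0 : 0 < s₀) (h : s₀ ≤ s) :
    (Real.sinh s)⁻¹ ≤ 2 * Real.exp (-s) / (1 - Real.exp (-(2 * s₀))) := by
  have h1 : Real.exp (-(2 * s)) ≤ Real.exp (-(2 * s₀)) := Real.exp_le_exp.2 (by linarith)
  have h2 : Real.exp (-(2 * s₀)) < 1 := Real.exp_lt_one_iff.2 (by linarith)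
  have h3 : Real.sinh s = Real.exp s * (1 - Real.exp (-(2 * s))) / 2 := by
    rw [Real.sinh_eq, mul_sub, ← Real.exp_add]; ring_nf
  have h4 := Real.exp_pos s
  have h5 : 0 < 1 - Real.exp (-(2 * s₀)) := by linarith
  rw [h3, inv_div, Real.exp_neg s, ← div_eq_mul_inv, div_div]
  exact div_le_div_of_nonneg_left zero_le_two (by positivity)
    (mul_le_mul_of_nonneg_left (by linarith) h4.le)

/-- The choice of `θ` makes `πd/θ` and `Kθ/2` both equal to `s = √(πdK/2)`. The discretization term
carries no power of `K`; the truncation term carries `1/√θ`, hence `K^{1/4}`. -/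
theorem errorConst_bound {d C N θ : ℝ} {K : ℕ} (hd : 0 < d) (hC : 0 < C) (hN : 0 ≤ N)
    (hK : 1 ≤ K) (hθ : θ = (2 * Real.pi * d / (K : ℝ)) ^ (1 / 2 : ℝ)) :
    (Real.sinh (Real.pi * d / θ))⁻¹ * (2 * N) + 8 * C * Real.exp (-(K * θ / 2)) / √θ ≤
      errorConst d * (K : ℝ) ^ (1 / 4 : ℝ) * Real.exp (-√(Real.pi * d * (K : ℝ) / 2)) *
        (N + C) := by
  have hpi := Real.pi_pos
  have hK1 : (1 : ℝ) ≤ K := by exact_mod_cast hK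
  have hK0 : (0 : ℝ) < K := by linarith
  rw [← Real.sqrt_eq_rpow] at hθ
  have hθ0 : 0 < θ := by rw [hθ]; exact Real.sqrt_pos.2 (by positivity)
  have hθ2 : θ ^ 2 = 2 * Real.pi * d / K := by rw [hθ, Real.sq_sqrt (by positivity)]
  set s := √(Real.pi * d * (K : ℝ) / 2) with hs
  have hs1 : K * θ / 2 = s := by
    rw [hs, eq_comm, Real.sqrt_eq_iff_mul_self_eq (by positivity) (by positivity)]
    have : K * θ / 2 * (K * θ / 2) = K ^ 2 * θ ^ 2 / 4 := by ring
    rw [this, hθ2]; field_simp; ring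
  have hs2 : Real.pi * d / θ = s := by
    rw [← hs1, div_eq_div_iff hθ0.ne' two_ne_zero]
    have : K * θ * θ = K * θ ^ 2 := by ring
    rw [this, hθ2]; field_simp
  -- As `K ≥ 1`, `s` is at least its value at `K = 1`; this makes the factor in the bound for
  -- `1/sinh s` depend on `d` only.
  have hs0 : √(Real.pi * d / 2) ≤ s := Real.sqrt_le_sqrt (by
    have : 0 < Real.pi * d := by positivity
    nlinarith)
  have hK4 : (K : ℝ) ^ (1 / 4 : ℝ) = √√(K : ℝ) := by
    rw [Real.sqrt_eq_rpow, Real.sqrt_eq_rpow, ← Real.rpow_mul hK0.le]; norm_num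
  have hK41 : 1 ≤ √√(K : ℝ) := Real.one_le_sqrt.2 (Real.one_le_sqrt.2 hK1)
  have hθ4 : √θ = √√(2 * Real.pi * d) / √√(K : ℝ) := by
    rw [hθ, Real.sqrt_div (by positivity), Real.sqrt_div (Real.sqrt_nonneg _)]
  rw [hs1, hs2, hK4, hθ4, errorConst]
  have hA := one_sub_exp_pos hd
  have hB : 0 < √√(2 * Real.pi * d) := Real.sqrt_pos.2 (Real.sqrt_pos.2 (by positivity))
  have hE := Real.exp_pos (-s)
  have h1 := inv_sinh_le (Real.sqrt_pos.2 (by positivity : 0 < Real.pi * d / 2)) hs0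
  set A := 1 - Real.exp (-(2 * √(Real.pi * d / 2))) with hAdef
  set B := √√(2 * Real.pi * d)
  set k := √√(K : ℝ)
  set E := Real.exp (-s)
  have hk : 0 < k := by linarith
  calc _ ≤ 2 * E / A * (2 * N) + 8 * C * E / (B / k) := by
        gcongr
    _ = 4 / A * E * N * 1 + 8 / B * k * E * C := by field_simp; ring
    -- The nonnegative cross terms are added so that the sum factors as a constant times `N + C`.
    _ ≤ 4 / A * E * N * k + 8 / B * k * E * C + (4 / A * k * E * C + 8 / B * k * E * N) := by
        have : 0 ≤ 4 / A * k * E * C + 8 / B * k * E * N := by positivity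
        have : 4 / A * E * N * 1 ≤ 4 / A * E * N * k :=
          mul_le_mul_of_nonneg_left hK41 (by positivity)
        linarith
    _ = _ := by ring

end Constants

end SincApprox

/-! ### The main theorem -/

theorem theoremC2 :
    ∃ Cd : ℝ → ℝ,
      (∀ d ∈ Set.Ioo (0 : ℝ) (Real.pi / 2), 0 < Cd d) ∧
      Filter.Tendsto Cd (nhdsWithin 0 (Set.Ioi 0)) Filter.atTop ∧
      ∀ (X : Type*) [NormedAddCommGroup X] [InnerProductSpace ℂ X] [CompleteSpace X]
        (d : ℝ), d ∈ Set.Ioo (0 : ℝ) (Real.pi / 2) →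
        ∀ (F : ℂ → X), SincApprox.MemHardy 2 d F →
        ∀ C : ℝ, 0 < C → (∀ x : ℝ, ‖F (x : ℂ)‖ ≤ C / √(1 + x ^ 2)) →
        ∀ K : ℕ, 1 ≤ K → ∀ θ : ℝ, θ = (2 * Real.pi * d / (K : ℝ)) ^ (1 / 2 : ℝ) →
          MeasureTheory.MemLp (fun x : ℝ => F (x : ℂ) - SincApprox.interpolant θ K F x) 2
            MeasureTheory.volume ∧
          MeasureTheory.eLpNorm (fun x : ℝ => F (x : ℂ) - SincApprox.interpolant θ K F x) 2
            MeasureTheory.volume ≤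
          ENNReal.ofReal
            (Cd d * (K : ℝ) ^ (1 / 4 : ℝ) * Real.exp (-√(Real.pi * d * (K : ℝ) / 2)) *
              ((SincApprox.hardyNorm 2 d F).toReal + C)) := by
  refine ⟨SincApprox.errorConst, fun d hd => SincApprox.errorConst_pos hd.1,
    SincApprox.tendsto_errorConst, ?_⟩
  intro X _ _ _ d ⟨hd0, hd⟩ F ⟨hFa, hFn⟩ C hC hF K hK θ hθ
  have hpi := Real.pi_pos
  have hK0 : (0 : ℝ) < K := by exact_mod_cast hK
  have hθ0 : 0 < θ := by rw [hθ]; positivity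
  have hcont : Continuous fun x : ℝ => F x :=
    hFa.continuousOn.comp_continuous Complex.continuous_ofReal
      (SincApprox.ofReal_mem_domain hd0 hd)
  have hbound : MeasureTheory.eLpNorm (fun x : ℝ => F (x : ℂ) - SincApprox.interpolant θ K F x) 2
      MeasureTheory.volume ≤
      ENNReal.ofReal
        (SincApprox.errorConst d * (K : ℝ) ^ (1 / 4 : ℝ) *
          Real.exp (-√(Real.pi * d * (K : ℝ) / 2)) *
          ((SincApprox.hardyNorm 2 d F).toReal + C)) := by
    rw [SincApprox.eLpNorm_sub_interpolant]
    refine (SincApprox.eLpNorm_sub_sincSum_le_of_hardy hd0 hθ0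
      (SincApprox.differentiableOn_pullback hd hFa) hFn.ne
      (fun y hy0 hy => SincApprox.eLpNorm_pullback_line_le F hy0 hy) K
      fun n => SincApprox.sum_sdiff_norm_pullback_le hC hθ0 hF n K).trans ?_
    refine le_trans (le_of_eq ?_) (ENNReal.ofReal_le_ofReal (SincApprox.errorConst_bound hd0 hC
      ENNReal.toReal_nonneg hK hθ))
    have hsinh : 0 ≤ (Real.sinh (Real.pi * d / θ))⁻¹ :=
      inv_nonneg.2 (Real.sinh_nonneg_iff.2 (by positivity))
    rw [ENNReal.ofReal_add (by positivity) (by positivity), ENNReal.ofReal_mul hsinh,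
      ENNReal.ofReal_mul zero_le_two, ENNReal.ofReal_toReal hFn.ne, ENNReal.ofReal_ofNat]
  exact ⟨⟨(hcont.sub (SincApprox.continuous_interpolant θ K F)).aestronglyMeasurable,
    hbound.trans_lt ENNReal.ofReal_lt_top⟩, hbound⟩
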